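/- Let $0<q<1$ and let $A$ be the symmetric operator in $\ell^2(\mathbb{Z})$ with domain $\operatorname{span}\{e_n : n\in\mathbb{Z}\}$ and $Ae_n=q^{-n+1}e_{n-1}+q^{-n}e_{n+1}$. For a sequence $\psi$ put $(\mathcal{A}\psi)_n=q^{-n+1}\psi_{n-1}+q^{-n}\psi_{n+1}$, and let $D=\{\psi\in\ell^2(\mathbb{Z}) : \mathcal{A}\psi\in\ell^2(\mathbb{Z})\}$. For $t\in\mathbb{R}\cup\{\infty\}$ let $A_t$ act as $\mathcal{A}$ on \[ \operatorname{Dom}A_t=\Big\{\psi\in D : \lim_{n\to\infty}q^{-n}(\psi_{2n+1}+t\psi_{2n})=0 \text{ and } \lim_{n\to\infty}q^{-n}(q\psi_{2n-1}-t\psi_{2n})=0\Big\}\quad (t\in\mathbb{R}), \] \[ \operatorname{Dom}A_\infty=\Big\{\psi\in D : \lim_{n\to\infty}q^{-n}\psi_{2n}=0\Big\}. \] Write $(a;q)_\infty=\prod_{n\ge0}(1-aq^n)$ and $\theta_q(x)=(x;q)_\infty(qx^{-1};q)_\infty$, and let $\vartheta_1(z\mid q)=\mathrm{i}q^{1/4}e^{-\mathrm{i}z}(q^2;q^2)_\infty\theta_{q^2}(e^{2\mathrm{i}z})$,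 $\vartheta_2(z\mid q)=q^{1/4}e^{-\mathrm{i}z}(q^2;q^2)_\infty\theta_{q^2}(-e^{2\mathrm{i}z})$, $\vartheta_3(z\mid q)=(q^2;q^2)_\infty\theta_{q^2}(-qe^{2\mathrm{i}z})$, $\vartheta_4(z\mid q)=(q^2;q^2)_\infty\theta_{q^2}(qe^{2\mathrm{i}z})$ be the Jacobi theta functions. Write $\vartheta_j=\vartheta_j(0\mid q^2)$ for $j=2,3,4$ and \[ \Phi(s)=\mathrm{i}q^{1/2}\,\frac{\vartheta_4(\mathrm{i}s\mid q^2)}{\vartheta_1(\mathrm{i}s\mid q^2)},\qquad \Phi(0)=\infty . \] Then the following hold. 1. The operators $A_t$, $t\in\mathbb{R}\cup\{\infty\}$, are precisely the self-adjoint extensions of $A$. 2. $\Phi$ is real-valued and strictly decreasing on $(0,-2\ln q)$, and maps $[0,-2\ln q)$ bijectively onto $\mathbb{R}\cup\{\infty\}$. On $(0,-2\ln q)$ one has $\Phi(s)=q^{1/2}\frac{\vartheta_3}{\vartheta_2}\operatorname{cs}(s\vartheta_3^2,k')$ with modulus $k'=\vartheta_4^2/\vartheta_3^2$, where $\operatorname{cs}=\operatorname{cn}/\operatorname{sn}$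 is the Jacobian elliptic function. The inverse of $\Phi:[0,-2\ln q)\to\mathbb{R}\cup\{\infty\}$ is given by the convergent elliptic integral \[ \Phi^{-1}(t)=\frac{q^{1/2}}{\vartheta_2\vartheta_3}\int_t^\infty\left[\left(\frac{q\,\vartheta_3^2}{\vartheta_2^2}+x^2\right)\left(\frac{q\,\vartheta_2^2}{\vartheta_3^2}+x^2\right)\right]^{-1/2}dx , \] read as $0$ for $t=\infty$. 3. For every $t\in\mathbb{R}\cup\{\infty\}$, with $s=\Phi^{-1}(t)$, the point spectrum (the set of eigenvalues) of $A_t$ is \[ \operatorname{spec}_p(A_t)=\{-e^{-s}q^{2m} : m\in\mathbb{Z}\}\cup\{e^{s}q^{2n} : n\in\mathbb{Z}\}. \] -/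

import Mathlib

open Filter Topology Set

noncomputable section

/-- The Hilbert space `ℓ²(ℤ)` of square summable complex sequences. -/
abbrev EllTwo : Type := lp (fun _ : ℤ => ℂ) 2

/-- The standard basis vector `e_n` of `ℓ²(ℤ)`. -/
def basisVec (n : ℤ) : EllTwo := lp.single 2 n (1 : ℂ)

/-- The doubly infinite Jacobi matrix applied to a sequence:
`(𝒜 ψ)_n = q^{-n+1} ψ_{n-1} + q^{-n} ψ_{n+1}`. -/
def jacobiExpr (q : ℝ) (ψ : ℤ → ℂ) (n : ℤ) : ℂ :=
  (q : ℂ) ^ (-n + 1) * ψ (n - 1) + (q : ℂ) ^ (-n) * ψ (n + 1)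

theorem jacobiExpr_add (q : ℝ) (ψ χ : ℤ → ℂ) :
    jacobiExpr q (ψ + χ) = jacobiExpr q ψ + jacobiExpr q χ := by
  funext n
  simp only [jacobiExpr, Pi.add_apply]
  ring

theorem jacobiExpr_smul (q : ℝ) (c : ℂ) (ψ : ℤ → ℂ) :
    jacobiExpr q (c • ψ) = c • jacobiExpr q ψ := by
  funext n
  simp only [jacobiExpr, Pi.smul_apply, smul_eq_mul]
  ring

theorem jacobiExpr_zero (q : ℝ) : jacobiExpr q 0 = 0 := by
  funext n
  simp [jacobiExpr]

/-- The maximal domain `D = {ψ ∈ ℓ²(ℤ) ∣ 𝒜 ψ ∈ ℓ²(ℤ)}`. -/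
def maxDomain (q : ℝ) : Submodule ℂ EllTwo where
  carrier := {ψ | Memℓp (jacobiExpr q ψ) 2}
  add_mem' := by
    intro a b ha hb
    simp only [mem_ofPred_eq, lp.coeFn_add, jacobiExpr_add] at *
    exact ha.add hb
  zero_mem' := by
    simp only [mem_ofPred_eq, lp.coeFn_zero, jacobiExpr_zero]
    exact zero_memℓp
  smul_mem' := by
    intro c a ha
    simp only [mem_ofPred_eq, lp.coeFn_smul, jacobiExpr_smul] at *
    exact ha.const_smul c

/-- The maximal operator `A_max`: the Jacobi matrix acting on the domain `D`. -/
def Amax (q : ℝ) : EllTwo →ₗ.[ℂ] EllTwo where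
  domain := maxDomain q
  toFun :=
    { toFun := fun ψ => ⟨jacobiExpr q (ψ : EllTwo), ψ.2⟩
      map_add' := by
        intro a b
        apply lp.ext
        simp only [Submodule.coe_add, lp.coeFn_add, jacobiExpr_add]
      map_smul' := by
        intro c a
        apply lp.ext
        simp only [Submodule.coe_smul, lp.coeFn_smul, jacobiExpr_smul, RingHom.id_apply] }

/-- The operator `A` with domain `span {e_n ∣ n ∈ ℤ}` (see `Amin_domain` and `Amin_basisVec`). -/
def Amin (q : ℝ) : EllTwo →ₗ.[ℂ] EllTwo :=
  (Amax q).domRestrict (Submodule.span ℂ (range basisVec))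

theorem jacobiExpr_basisVec (q : ℝ) (n : ℤ) :
    jacobiExpr q (basisVec n) =
      ⇑((q : ℂ) ^ (-n + 1) • basisVec (n - 1) + (q : ℂ) ^ (-n) • basisVec (n + 1)) := by
  funext k
  simp only [jacobiExpr, basisVec, lp.coeFn_add, lp.coeFn_smul, Pi.add_apply, Pi.smul_apply,
    lp.coeFn_single, smul_eq_mul, Pi.single_apply]
  by_cases h1 : k = n + 1
  · subst h1
    have h2 : ¬ (n + 1 + 1 = n) := by omega
    have h3 : ¬ (n + 1 = n - 1) := by omega
    simp [h2, h3]
  · by_cases h2 : k = n - 1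
    · subst h2
      have h3 : ¬ (n - 1 - 1 = n) := by omega
      have h4 : ¬ (n - 1 = n + 1) := by omega
      have h5 : -(n - 1) = -n + 1 := by ring
      simp [h3, h4, h5]
    · have h3 : ¬ (k - 1 = n) := by omega
      have h4 : ¬ (k + 1 = n) := by omega
      simp [h1, h2, h3, h4]

theorem basisVec_mem_maxDomain (q : ℝ) (n : ℤ) : basisVec n ∈ maxDomain q := by
  change Memℓp (jacobiExpr q (basisVec n)) 2
  rw [jacobiExpr_basisVec]
  exact lp.memℓp _

theorem Amin_domain (q : ℝ) : (Amin q).domain = Submodule.span ℂ (range basisVec) := by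
  refine inf_eq_left.mpr (Submodule.span_le.mpr ?_)
  rintro _ ⟨n, rfl⟩
  exact basisVec_mem_maxDomain q n

/-- `A e_n = q^{-n+1} e_{n-1} + q^{-n} e_{n+1}`. -/
theorem Amin_basisVec (q : ℝ) (n : ℤ) (h : basisVec n ∈ (Amin q).domain) :
    Amin q ⟨basisVec n, h⟩ =
      (q : ℂ) ^ (-n + 1) • basisVec (n - 1) + (q : ℂ) ^ (-n) • basisVec (n + 1) :=
  lp.ext (jacobiExpr_basisVec q n)

/-- The boundary condition at `+∞` labelled by `t ∈ ℝ ∪ {∞}`. -/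
def BoundaryCond (q : ℝ) (ψ : ℤ → ℂ) : OnePoint ℝ → Prop
  | OnePoint.some t =>
      Tendsto (fun n : ℤ => (q : ℂ) ^ (-n) * (ψ (2 * n + 1) + (t : ℂ) * ψ (2 * n)))
          atTop (𝓝 0) ∧
        Tendsto (fun n : ℤ => (q : ℂ) ^ (-n) * ((q : ℂ) * ψ (2 * n - 1) - (t : ℂ) * ψ (2 * n)))
          atTop (𝓝 0)
  | OnePoint.infty => Tendsto (fun n : ℤ => (q : ℂ) ^ (-n) * ψ (2 * n)) atTop (𝓝 0)

theorem BoundaryCond.add {q : ℝ} {ψ χ : ℤ → ℂ} {t : OnePoint ℝ}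
    (h₁ : BoundaryCond q ψ t) (h₂ : BoundaryCond q χ t) : BoundaryCond q (ψ + χ) t := by
  induction t using OnePoint.rec with
  | infty =>
    have h := Tendsto.add (f := fun n : ℤ => (q : ℂ) ^ (-n) * ψ (2 * n)) h₁ h₂
    rw [add_zero] at h
    exact h.congr fun n => by simp only [Pi.add_apply]; ring
  | coe t =>
    have ha := Tendsto.add h₁.1 h₂.1
    have hb := Tendsto.add h₁.2 h₂.2
    rw [add_zero] at ha hb
    exact ⟨ha.congr fun n => by simp only [Pi.add_apply]; ring,
      hb.congr fun n => by simp only [Pi.add_apply]; ring⟩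

theorem BoundaryCond.smul {q : ℝ} {ψ : ℤ → ℂ} {t : OnePoint ℝ} (c : ℂ)
    (h : BoundaryCond q ψ t) : BoundaryCond q (c • ψ) t := by
  induction t using OnePoint.rec with
  | infty =>
    have h' := Tendsto.const_mul (f := fun n : ℤ => (q : ℂ) ^ (-n) * ψ (2 * n)) c h
    rw [mul_zero] at h'
    exact h'.congr fun n => by simp only [Pi.smul_apply, smul_eq_mul]; ring
  | coe t =>
    have ha := Tendsto.const_mul c h.1
    have hb := Tendsto.const_mul c h.2
    rw [mul_zero] at ha hb
    exact ⟨ha.congr fun n => by simp only [Pi.smul_apply, smul_eq_mul]; ring,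
      hb.congr fun n => by simp only [Pi.smul_apply, smul_eq_mul]; ring⟩

theorem BoundaryCond.zero (q : ℝ) (t : OnePoint ℝ) : BoundaryCond q 0 t := by
  induction t using OnePoint.rec with
  | infty => simp [BoundaryCond]
  | coe t => simp [BoundaryCond]

/-- The sequences in `ℓ²(ℤ)` satisfying the boundary condition labelled by `t`. -/
def boundarySubmodule (q : ℝ) (t : OnePoint ℝ) : Submodule ℂ EllTwo where
  carrier := {ψ | BoundaryCond q ψ t}
  add_mem' := fun ha hb => BoundaryCond.add ha hb
  zero_mem' := BoundaryCond.zero q t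
  smul_mem' := fun c _ ha => BoundaryCond.smul c ha

/-- The operator `A_t ⊂ A_max` whose domain consists of all `ψ ∈ D` satisfying the boundary
condition labelled by `t`. -/
def At (q : ℝ) (t : OnePoint ℝ) : EllTwo →ₗ.[ℂ] EllTwo :=
  (Amax q).domRestrict (boundarySubmodule q t)

/-- The point spectrum (set of eigenvalues) of an unbounded operator on `ℓ²(ℤ)`. -/
def pointSpectrum (T : EllTwo →ₗ.[ℂ] EllTwo) : Set ℂ :=
  {x | ∃ ψ : T.domain, (ψ : EllTwo) ≠ 0 ∧ T ψ = x • (ψ : EllTwo)}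

/-- The infinite `q`-Pochhammer symbol `(a; q)_∞ = ∏_{n ≥ 0} (1 - a qⁿ)`. -/
def qPochInf (a : ℂ) (q : ℝ) : ℂ := ∏' n : ℕ, (1 - a * (q : ℂ) ^ n)

/-- `θ_q(x) = (x, q x⁻¹; q)_∞`. -/
def thetaQ (q : ℝ) (x : ℂ) : ℂ := qPochInf x q * qPochInf (q * x⁻¹) q

/-- The Jacobi theta function `ϑ₁(z ∣ q)`, with nome `q`. -/
def thetaOne (z : ℂ) (q : ℝ) : ℂ :=
  Complex.I * ((q ^ (1 / 4 : ℝ) : ℝ) : ℂ) * Complex.exp (-Complex.I * z) *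
    qPochInf ((q : ℂ) ^ 2) (q ^ 2) * thetaQ (q ^ 2) (Complex.exp (2 * Complex.I * z))

/-- The Jacobi theta function `ϑ₂(z ∣ q)`, with nome `q`. -/
def thetaTwo (z : ℂ) (q : ℝ) : ℂ :=
  ((q ^ (1 / 4 : ℝ) : ℝ) : ℂ) * Complex.exp (-Complex.I * z) *
    qPochInf ((q : ℂ) ^ 2) (q ^ 2) * thetaQ (q ^ 2) (-Complex.exp (2 * Complex.I * z))

/-- The Jacobi theta function `ϑ₃(z ∣ q)`, with nome `q`. -/
def thetaThree (z : ℂ) (q : ℝ) : ℂ :=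
  qPochInf ((q : ℂ) ^ 2) (q ^ 2) * thetaQ (q ^ 2) (-q * Complex.exp (2 * Complex.I * z))

/-- The Jacobi theta function `ϑ₄(z ∣ q)`, with nome `q`. -/
def thetaFour (z : ℂ) (q : ℝ) : ℂ :=
  qPochInf ((q : ℂ) ^ 2) (q ^ 2) * thetaQ (q ^ 2) (q * Complex.exp (2 * Complex.I * z))

/-- The theta constant `ϑ₂(0 ∣ q)`, which is real for `0 < q < 1`, as a real number. -/
def thetaTwoConst (q : ℝ) : ℝ := (thetaTwo 0 q).re

/-- The theta constant `ϑ₃(0 ∣ q)`, which is real for `0 < q < 1`, as a real number. -/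
def thetaThreeConst (q : ℝ) : ℝ := (thetaThree 0 q).re

/-- The theta constant `ϑ₄(0 ∣ q)`, which is real for `0 < q < 1`, as a real number. -/
def thetaFourConst (q : ℝ) : ℝ := (thetaFour 0 q).re

/-- `Φ(s) = i q^{1/2} ϑ₄(i s ∣ q²) / ϑ₁(i s ∣ q²)`, as a complex number. -/
def Phi (q : ℝ) (s : ℝ) : ℂ :=
  Complex.I * ((q ^ (1 / 2 : ℝ) : ℝ) : ℂ) *
    (thetaFour (Complex.I * s) (q ^ 2) / thetaOne (Complex.I * s) (q ^ 2))

/-- `Φ` as a map into `ℝ ∪ {∞}`, with the convention `Φ(0) = ∞`. -/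
def PhiExt (q : ℝ) (s : ℝ) : OnePoint ℝ :=
  if s = 0 then OnePoint.infty else OnePoint.some (Phi q s).re

/-- The integrand of the elliptic integral for `Φ⁻¹`; the theta constants have nome `q²`. -/
def ellipticIntegrand (q : ℝ) (x : ℝ) : ℝ :=
  ((q * thetaThreeConst (q ^ 2) ^ 2 / thetaTwoConst (q ^ 2) ^ 2 + x ^ 2) *
    (q * thetaTwoConst (q ^ 2) ^ 2 / thetaThreeConst (q ^ 2) ^ 2 + x ^ 2)) ^ (-1 / 2 : ℝ)

/-- The elliptic integral formula for `Φ⁻¹(t)`; it is read as `0` for `t = ∞`. -/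
def PhiInv (q : ℝ) : OnePoint ℝ → ℝ
  | OnePoint.some t =>
      q ^ (1 / 2 : ℝ) / (thetaTwoConst (q ^ 2) * thetaThreeConst (q ^ 2)) *
        ∫ x in Ioi t, ellipticIntegrand q x
  | OnePoint.infty => 0

/-- The incomplete elliptic integral of the first kind `F(φ, k)`, with modulus `k`. -/
def ellipticF (k φ : ℝ) : ℝ := ∫ θ in (0 : ℝ)..φ, 1 / √(1 - k ^ 2 * Real.sin θ ^ 2)

/-- Jacobi's amplitude `am(u, k)` for a modulus `0 ≤ k < 1`: the inverse of `φ ↦ F(φ, k)`, which is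
an increasing bijection of the real line. -/
def jacobiAm (u k : ℝ) : ℝ := Function.invFun (ellipticF k) u

/-- The Jacobian elliptic function `cs(u, k) = cn(u, k) / sn(u, k)`, where `cn = cos am` and
`sn = sin am`. -/
def jacobiCs (u k : ℝ) : ℝ := Real.cos (jacobiAm u k) / Real.sin (jacobiAm u k)

end

/-!
Rescaled by `(-q)ⁿ`, the even and odd entries of a sequence in the maximal domain have limits
`a` and `b` at `+∞`, whereas nothing survives at `-∞`. Green's formula expresses the defect of
symmetry through these boundary values as `b̄ c - ā d`, so the self-adjoint extensions correspond to
the Lagrangian lines of this form, and these are parametrized by `ℝ ∪ {∞}`.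

For every `x ≠ 0` the equation `𝒜 ψ = x ψ` has, up to a factor, only one solution that is bounded
at `-∞`. Up to powers of `-q` its even and odd entries are theta series with damped terms,
converging to theta functions, and its boundary values for `x = eˢ` and for `x = -e⁻ˢ` are both
proportional to `(θ₁(s), -θ₄(s))`, where `θ₁` and `θ₄` are real multiples of `ϑ₁` and `ϑ₄` along the
imaginary axis. Hence the eigenvalues of `A_t` are given by the solutions of `θ₄(s) / θ₁(s) = t`.

This quotient is `Φ`. It satisfies `Φ' = -c √((α + Φ²)(β + Φ²))`, since the Wronskian of `ϑ₁` and
`ϑ₄` is a multiple of `ϑ₂ ϑ₃` and the squares of the theta functions are linearly related.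
Separating variables gives the elliptic integral, and the substitution `x = cot φ` turns it into
`cs`.
-/

section QPochhammer

/-- The infinite `q`-Pochhammer symbol `(a; p)_∞ = ∏_{n ≥ 0} (1 - a pⁿ)` over a normed field. -/
noncomputable def qPochhammer {𝕜 : Type*} [NormedField 𝕜] (a p : 𝕜) : 𝕜 :=
  ∏' n : ℕ, (1 - a * p ^ n)

variable {𝕜 : Type*} [NormedField 𝕜]

theorem summable_norm_neg_mul_pow {p : 𝕜} (hp : ‖p‖ < 1) (a : 𝕜) :
    Summable fun n : ℕ => ‖-(a * p ^ n)‖ := by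
  simpa only [norm_neg, norm_mul, norm_pow] using
    (summable_geometric_of_lt_one (norm_nonneg p) hp).mul_left ‖a‖

theorem one_sub_pow_ne_zero {p : 𝕜} (hp : ‖p‖ < 1) {n : ℕ} (hn : n ≠ 0) : 1 - p ^ n ≠ 0 := by
  refine sub_ne_zero.mpr fun h => (pow_lt_one₀ (norm_nonneg p) hp hn).ne ?_
  rw [← norm_pow, ← h, norm_one]

variable [CompleteSpace 𝕜]

theorem multipliable_one_sub_mul_pow {p : 𝕜} (hp : ‖p‖ < 1) (a : 𝕜) :
    Multipliable fun n : ℕ => 1 - a * p ^ n := by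
  simpa only [sub_eq_add_neg] using
    multipliable_one_add_of_summable (summable_norm_neg_mul_pow hp a)

theorem tendsto_prod_range_one_sub_mul_pow {p : 𝕜} (hp : ‖p‖ < 1) (a : 𝕜) :
    Tendsto (fun n : ℕ => ∏ k ∈ Finset.range n, (1 - a * p ^ k)) atTop (𝓝 (qPochhammer a p)) :=
  (multipliable_one_sub_mul_pow hp a).hasProd.tendsto_prod_nat

theorem qPochhammer_ne_zero {a p : 𝕜} (hp : ‖p‖ < 1) (h : ∀ n : ℕ, a * p ^ n ≠ 1) :
    qPochhammer a p ≠ 0 := by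
  simpa only [qPochhammer, sub_eq_add_neg] using
    tprod_one_add_ne_zero_of_summable (f := fun n : ℕ => -(a * p ^ n))
      (fun n => by rw [← sub_eq_add_neg, sub_ne_zero]; exact (h n).symm)
      (summable_norm_neg_mul_pow hp a)

theorem qPochhammer_self_ne_zero {p : 𝕜} (hp : ‖p‖ < 1) : qPochhammer p p ≠ 0 :=
  qPochhammer_ne_zero hp fun n h => one_sub_pow_ne_zero hp n.succ_ne_zero <| by
    rw [pow_succ', h, sub_self]

theorem qPochhammer_eq_one_sub_mul {p : 𝕜} (hp : ‖p‖ < 1) (a : 𝕜) :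
    qPochhammer a p = (1 - a) * qPochhammer (a * p) p := by
  rw [qPochhammer, tprod_eq_zero_mul']
  · simp only [pow_zero, mul_one, qPochhammer, pow_succ', mul_assoc]
  · simpa only [pow_succ', mul_assoc] using multipliable_one_sub_mul_pow hp (a * p)

theorem qPochhammer_mul_qPochhammer_neg {p : 𝕜} (hp : ‖p‖ < 1) (a : 𝕜) :
    qPochhammer a p * qPochhammer (-a) p = qPochhammer (a ^ 2) (p ^ 2) := by
  rw [qPochhammer, qPochhammer, qPochhammer, ← (multipliable_one_sub_mul_pow hp a).tprod_mul
    (multipliable_one_sub_mul_pow hp (-a))]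
  exact tprod_congr fun n => by ring

theorem qPochhammer_sq_mul_qPochhammer_sq {p : 𝕜} (hp : ‖p‖ < 1) (a : 𝕜) :
    qPochhammer a (p ^ 2) * qPochhammer (a * p) (p ^ 2) = qPochhammer a p := by
  have hp2 : ‖p ^ 2‖ < 1 := by
    rw [norm_pow]; exact pow_lt_one₀ (norm_nonneg p) hp two_ne_zero
  have hodd (n : ℕ) : 1 - a * p * (p ^ 2) ^ n = 1 - a * p ^ (2 * n + 1) := by ring
  have heven (n : ℕ) : 1 - a * (p ^ 2) ^ n = 1 - a * p ^ (2 * n) := by ring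
  simp only [qPochhammer, hodd, heven]
  exact tprod_even_mul_odd (f := fun n => 1 - a * p ^ n)
    ((multipliable_one_sub_mul_pow hp2 a).congr heven)
    ((multipliable_one_sub_mul_pow hp2 (a * p)).congr hodd)

theorem qPochhammer_neg_self_mul_qPochhammer_sq {p : 𝕜} (hp : ‖p‖ < 1) :
    qPochhammer (-p) p * qPochhammer p (p ^ 2) = 1 := by
  have h₁ := qPochhammer_mul_qPochhammer_neg hp p
  have h₂ := qPochhammer_sq_mul_qPochhammer_sq hp p
  rw [← sq, ← h₁] at h₂
  refine mul_left_cancel₀ (qPochhammer_self_ne_zero hp) ?_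
  linear_combination h₂

theorem continuous_qPochhammer_left {p : 𝕜} (hp : ‖p‖ < 1) :
    Continuous fun a => qPochhammer a p := by
  refine continuous_iff_continuousAt.mpr fun a => ?_
  have h := tendsto_tprod_one_add_of_dominated_convergence (𝓕 := 𝓝 a)
    (f := fun (x : 𝕜) (n : ℕ) => -(x * p ^ n)) (bound := fun n => (‖a‖ + 1) * ‖p‖ ^ n)
    ((summable_geometric_of_lt_one (norm_nonneg p) hp).mul_left _)
    (fun n => (tendsto_id.mul_const _).neg) ?_
  · simpa only [ContinuousAt, qPochhammer, sub_eq_add_neg] using h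
  · filter_upwards [continuous_norm.continuousAt.eventually_le_const (lt_add_one ‖a‖)] with x hx k
    rw [norm_neg, norm_mul, norm_pow]
    gcongr

end QPochhammer

theorem qPochhammer_pos {a p : ℝ} (hp0 : 0 ≤ p) (hp1 : p < 1) (ha : a < 1) :
    0 < qPochhammer a p := by
  have hp : ‖p‖ < 1 := by rwa [Real.norm_of_nonneg hp0]
  have hlt (n : ℕ) : a * p ^ n < 1 := by
    have h0 : 0 ≤ p ^ n := pow_nonneg hp0 n
    have h1 : p ^ n ≤ 1 := pow_le_one₀ hp0 hp1.le
    rcases le_or_gt a 0 with h | h <;> nlinarith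
  refine (qPochhammer_ne_zero hp fun n => (hlt n).ne).lt_of_le' ?_
  exact ge_of_tendsto' (tendsto_prod_range_one_sub_mul_pow hp a) fun n =>
    Finset.prod_nonneg fun k _ => sub_nonneg.mpr (hlt k).le

section InvPoch

/-- The reciprocal `1 / (p; p)_n` of the finite `q`-Pochhammer symbol, extended by `0` to `n < 0`,
so that the recurrence `invPoch_sub_one` holds for all integers. -/
noncomputable def invPoch {𝕜 : Type*} [NormedField 𝕜] (p : 𝕜) (n : ℤ) : 𝕜 :=
  if n < 0 then 0 else (∏ k ∈ Finset.range n.toNat, (1 - p ^ (k + 1)))⁻¹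

variable {𝕜 : Type*} [NormedField 𝕜] {p : 𝕜}

theorem invPoch_of_neg {n : ℤ} (hn : n < 0) : invPoch p n = 0 := if_pos hn

theorem invPoch_natCast (p : 𝕜) (n : ℕ) :
    invPoch p n = (∏ k ∈ Finset.range n, (1 - p ^ (k + 1)))⁻¹ := by
  simp [invPoch]

theorem invPoch_zero (p : 𝕜) : invPoch p 0 = 1 := by simp [invPoch]

theorem invPoch_sub_one (hp : ‖p‖ < 1) (n : ℤ) :
    invPoch p (n - 1) = (1 - p ^ n) * invPoch p n := by
  obtain hn | ⟨m, rfl⟩ := (lt_or_ge n 0).imp_right Int.eq_ofNat_of_zero_le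
  · rw [invPoch_of_neg hn, invPoch_of_neg (by omega), mul_zero]
  obtain _ | m := m
  · rw [invPoch_of_neg (by simp)]
    simp
  rw [Nat.cast_succ, add_sub_cancel_right, ← Nat.cast_succ, invPoch_natCast, invPoch_natCast,
    Finset.prod_range_succ, zpow_natCast, mul_inv, mul_comm,
    inv_mul_cancel_right₀ (one_sub_pow_ne_zero hp m.succ_ne_zero)]

variable [CompleteSpace 𝕜]

theorem tendsto_invPoch (hp : ‖p‖ < 1) : Tendsto (invPoch p) atTop (𝓝 (qPochhammer p p)⁻¹) := by
  rw [← Nat.map_cast_int_atTop, tendsto_map'_iff]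
  have h := (tendsto_prod_range_one_sub_mul_pow hp p).inv₀ (qPochhammer_self_ne_zero hp)
  exact h.congr fun n => by simp only [Function.comp_apply, invPoch_natCast, pow_succ']

theorem exists_norm_invPoch_le (hp : ‖p‖ < 1) : ∃ K, 0 ≤ K ∧ ∀ n, ‖invPoch p n‖ ≤ K := by
  have hnat := (tendsto_invPoch hp).comp tendsto_natCast_atTop_atTop
  obtain ⟨K, hK⟩ := hnat.norm.bddAbove_range
  have hK0 : 0 ≤ K := (norm_nonneg _).trans (hK ⟨0, rfl⟩)
  refine ⟨K, hK0, fun n => ?_⟩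
  obtain hn | ⟨m, rfl⟩ := (lt_or_ge n 0).imp_right Int.eq_ofNat_of_zero_le
  · rwa [invPoch_of_neg hn, norm_zero]
  · exact hK ⟨m, rfl⟩

end InvPoch

/-- The theta series `∑ r^(n²) wⁿ` over the integers, in terms of the nome `r` and a multiplicative
variable `w`; in the usual notation `w = e^(2iz)` gives `ϑ₃(z ∣ r)`. -/
noncomputable def thetaSeries {𝕜 : Type*} [NormedField 𝕜] (r w : 𝕜) : 𝕜 :=
  ∑' n : ℤ, r ^ (n ^ 2) * w ^ n

section ThetaSeries

variable {𝕜 : Type*} [NormedField 𝕜] {r w : 𝕜}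

theorem summable_pow_sq_mul_pow {r c : ℝ} (hr0 : 0 ≤ r) (hr1 : r < 1) (hc : 0 ≤ c) :
    Summable fun n : ℕ => r ^ (n ^ 2) * c ^ n := by
  obtain ⟨N, hN⟩ : ∃ N : ℕ, r ^ N * c ≤ 1 / 2 := by
    have h : Tendsto (fun n : ℕ => r ^ n * c) atTop (𝓝 (0 * c)) :=
      (tendsto_pow_atTop_nhds_zero_of_lt_one hr0 hr1).mul_const c
    rw [zero_mul] at h
    exact (h.eventually_le_const (by norm_num)).exists
  refine (summable_geometric_of_lt_one (r := 1 / 2) (by norm_num) (by norm_num)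
    ).of_norm_bounded_eventually_nat ?_
  filter_upwards [eventually_ge_atTop N] with n hn
  rw [sq, pow_mul, ← mul_pow, Real.norm_of_nonneg (by positivity)]
  gcongr
  exact (mul_le_mul_of_nonneg_right (pow_le_pow_of_le_one hr0 hr1.le hn) hc).trans hN

theorem summable_norm_thetaSeries (hr : ‖r‖ < 1) (w : 𝕜) :
    Summable fun n : ℤ => ‖r ^ (n ^ 2) * w ^ n‖ := by
  simp only [norm_mul, norm_zpow]
  refine Summable.of_nat_of_neg ?_ ?_
  · exact (summable_pow_sq_mul_pow (norm_nonneg r) hr (norm_nonneg w)).congr fun n => by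
      rw [zpow_natCast]; norm_cast
  · exact (summable_pow_sq_mul_pow (norm_nonneg r) hr (inv_nonneg.mpr (norm_nonneg w))).congr
      fun n => by rw [neg_sq, zpow_neg, ← inv_zpow, zpow_natCast]; norm_cast

theorem thetaSeries_inv (r w : 𝕜) : thetaSeries r w⁻¹ = thetaSeries r w := by
  rw [thetaSeries, thetaSeries, ← (Equiv.neg ℤ).tsum_eq]
  refine tsum_congr fun n => ?_
  rw [Equiv.neg_apply, neg_sq, inv_zpow', neg_neg]

theorem zpow_add_one_sq (hr0 : r ≠ 0) (n : ℤ) :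
    r ^ ((n + 1) ^ 2) = r ^ (n ^ 2) * (r ^ n) ^ 2 * r := by
  rw [show (n + 1) ^ 2 = n ^ 2 + n * 2 + 1 by ring, zpow_add₀ hr0, zpow_add₀ hr0, zpow_mul,
    zpow_one, ← zpow_natCast, Nat.cast_two]

theorem thetaSeries_sq_mul (hr0 : r ≠ 0) (hw : w ≠ 0) :
    r * w * thetaSeries r (r ^ 2 * w) = thetaSeries r w := by
  rw [thetaSeries, thetaSeries, ← tsum_mul_left, ← (Equiv.addRight (1 : ℤ)).tsum_eq
    fun n : ℤ => r ^ (n ^ 2) * w ^ n]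
  refine tsum_congr fun n => ?_
  rw [Equiv.coe_addRight, zpow_add_one_sq hr0, zpow_add_one₀ hw, mul_zpow, ← zpow_natCast r 2,
    zpow_comm, zpow_natCast]
  ring

variable [CompleteSpace 𝕜]

theorem hasSum_thetaSeries (hr : ‖r‖ < 1) (w : 𝕜) :
    HasSum (fun n : ℤ => r ^ (n ^ 2) * w ^ n) (thetaSeries r w) :=
  (summable_norm_thetaSeries hr w).of_norm.hasSum

theorem tendsto_tsum_mul_of_bounded {ι : Type*} {l : Filter ι} (hr : ‖r‖ < 1) (w : 𝕜) {K : ℝ}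
    {c : ι → ℤ → 𝕜} {L : 𝕜} (hK : ∀ i n, ‖c i n‖ ≤ K) (hc : ∀ n, Tendsto (c · n) l (𝓝 L)) :
    Tendsto (fun i => ∑' n : ℤ, r ^ (n ^ 2) * w ^ n * c i n) l (𝓝 (thetaSeries r w * L)) := by
  rw [thetaSeries, ← tsum_mul_right]
  refine tendsto_tsum_of_dominated_convergence ((summable_norm_thetaSeries hr w).mul_right K)
    (fun n => (hc n).const_mul _) (Eventually.of_forall fun i n => ?_)
  rw [norm_mul]
  exact mul_le_mul_of_nonneg_left (hK i n) (norm_nonneg _)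

end ThetaSeries

section TripleProduct

variable {𝕜 : Type*} [NormedField 𝕜] {r : 𝕜}

theorem norm_sq_lt_one (hr : ‖r‖ < 1) : ‖r ^ 2‖ < 1 := by
  rw [norm_pow]
  exact pow_lt_one₀ (norm_nonneg r) hr two_ne_zero

theorem sq_zpow (r : 𝕜) (n : ℤ) : (r ^ 2) ^ n = (r ^ n) ^ 2 := by
  rw [← zpow_natCast, ← zpow_natCast, zpow_comm]

theorem invPoch_mul_invPoch_recurrence (hr0 : r ≠ 0) (hr : ‖r‖ < 1) (n j : ℤ) :
    (1 - (r ^ 2) ^ (2 * n + 1)) * (1 - (r ^ 2) ^ (2 * n + 2)) *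
        (invPoch (r ^ 2) (n + 1 + j) * invPoch (r ^ 2) (n + 1 - j)) =
      (1 + (r ^ 2) ^ (2 * n + 1)) * (invPoch (r ^ 2) (n + j) * invPoch (r ^ 2) (n - j)) +
        (r ^ 2) ^ (n + 1 - j) * (invPoch (r ^ 2) (n + (j - 1)) * invPoch (r ^ 2) (n - (j - 1))) +
        (r ^ 2) ^ (n + 1 + j) *
          (invPoch (r ^ 2) (n + (j + 1)) * invPoch (r ^ 2) (n - (j + 1))) := by
  have hp := norm_sq_lt_one hr
  have hp0 : r ^ 2 ≠ 0 := pow_ne_zero 2 hr0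
  have e₁ := invPoch_sub_one hp (n + 1 + j)
  have e₂ := invPoch_sub_one hp (n + 1 - j)
  have e₃ := invPoch_sub_one hp (n + j)
  have e₄ := invPoch_sub_one hp (n - j)
  rw [show n + 1 + j - 1 = n + j by ring] at e₁
  rw [show n + 1 - j - 1 = n - j by ring] at e₂
  rw [show n + (j - 1) = n + j - 1 by ring, show n - (j + 1) = n - j - 1 by ring,
    show n - (j - 1) = n + 1 - j by ring, show n + (j + 1) = n + 1 + j by ring, e₃, e₄, e₁, e₂]
  simp only [show 2 * n + 1 = n + n + 1 by ring, show 2 * n + 2 = n + n + 1 + 1 by ring,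
    zpow_add₀ hp0, zpow_sub₀ hp0, zpow_one]
  have hj : (r ^ 2) ^ j ≠ 0 := zpow_ne_zero j hp0
  generalize (r ^ 2) ^ n = A, (r ^ 2) ^ j = B at hj ⊢
  field_simp
  ring

theorem thetaSeries_term_succ (hr0 : r ≠ 0) {w : 𝕜} (hw : w ≠ 0) (n j : ℤ) :
    r / w * (r ^ 2) ^ n * (r ^ ((j + 1) ^ 2) * w ^ (j + 1)) =
      r ^ (j ^ 2) * w ^ j * (r ^ 2) ^ (n + 1 + j) := by
  have hp0 : r ^ 2 ≠ 0 := pow_ne_zero 2 hr0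
  rw [zpow_add_one_sq hr0, zpow_add_one₀ hw, zpow_add₀ hp0, zpow_add_one₀ hp0, sq_zpow r j]
  field_simp

theorem thetaSeries_term_pred (hr0 : r ≠ 0) {w : 𝕜} (hw : w ≠ 0) (n j : ℤ) :
    r * w * (r ^ 2) ^ n * (r ^ ((j - 1) ^ 2) * w ^ (j - 1)) =
      r ^ (j ^ 2) * w ^ j * (r ^ 2) ^ (n + 1 - j) := by
  have h := thetaSeries_term_succ hr0 (inv_ne_zero hw) n (-j)
  rw [show (-j + 1) ^ 2 = (j - 1) ^ 2 by ring, show -j + 1 = -(j - 1) by ring, neg_sq,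
    div_inv_eq_mul, inv_zpow', inv_zpow', neg_neg, neg_neg, ← sub_eq_add_neg] at h
  exact h

theorem hasSum_finite_triple_product (hr0 : r ≠ 0) (hr : ‖r‖ < 1) {w : 𝕜} (hw : w ≠ 0) (n : ℕ) :
    HasSum (fun j : ℤ => r ^ (j ^ 2) * w ^ j * (invPoch (r ^ 2) (n + j) * invPoch (r ^ 2) (n - j)))
      (invPoch (r ^ 2) (2 * n) * ∏ k ∈ Finset.range n,
        ((1 - -(r * w) * (r ^ 2) ^ k) * (1 - -(r / w) * (r ^ 2) ^ k))) := by
  have hp := norm_sq_lt_one hr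
  induction n with
  | zero =>
    convert hasSum_single (0 : ℤ) fun j hj => ?_ using 1
    · simp [invPoch_zero]
    · rcases hj.lt_or_gt with h | h
      · rw [invPoch_of_neg (n := (0 : ℕ) + j) (by simpa using h), zero_mul, mul_zero]
      · rw [invPoch_of_neg (n := (0 : ℕ) - j) (by simpa using h), mul_zero, mul_zero]
  | succ n ih =>
    have hD : (1 - (r ^ 2) ^ (2 * (n : ℤ) + 1)) * (1 - (r ^ 2) ^ (2 * (n : ℤ) + 2)) ≠ 0 :=
      mul_ne_zero (mod_cast one_sub_pow_ne_zero hp (2 * n).succ_ne_zero)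
        (mod_cast one_sub_pow_ne_zero hp (2 * n + 1).succ_ne_zero)
    have hpred := (Equiv.subRight (1 : ℤ)).hasSum_iff.mpr ih
    have hsucc := (Equiv.addRight (1 : ℤ)).hasSum_iff.mpr ih
    have hsum := ((ih.mul_left (1 + (r ^ 2) ^ (2 * (n : ℤ) + 1))).add
      (hpred.mul_left (r * w * (r ^ 2) ^ (n : ℤ)))).add (hsucc.mul_left (r / w * (r ^ 2) ^ (n : ℤ)))
    rw [← hasSum_mul_left_iff hD]
    convert! hsum using 1
    · funext j
      simp only [Function.comp_apply, Equiv.coe_addRight, Equiv.subRight_apply, Nat.cast_succ]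
      linear_combination (r ^ (j ^ 2) * w ^ j) * invPoch_mul_invPoch_recurrence hr0 hr n j -
        (invPoch (r ^ 2) (n + (j + 1)) * invPoch (r ^ 2) (n - (j + 1))) *
          thetaSeries_term_succ hr0 hw n j -
        (invPoch (r ^ 2) (n + (j - 1)) * invPoch (r ^ 2) (n - (j - 1))) *
          thetaSeries_term_pred hr0 hw n j
    · have h₁ := invPoch_sub_one hp (2 * n + 1)
      have h₂ := invPoch_sub_one hp (2 * n + 2)
      rw [add_sub_cancel_right] at h₁
      rw [show (2 * n + 2 - 1 : ℤ) = 2 * n + 1 by ring] at h₂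
      have hpow : (r ^ 2) ^ (2 * (n : ℤ) + 1) = r ^ 2 * ((r ^ 2) ^ n) ^ 2 := by
        norm_cast; ring
      have hw' : r * w * (r / w) = r ^ 2 := by field_simp
      rw [Finset.prod_range_succ, Nat.cast_succ, mul_add_one, h₁, h₂, hpow, zpow_natCast, ← hw']
      ring

theorem thetaSeries_eq_triple_product [CompleteSpace 𝕜] (hr0 : r ≠ 0) (hr : ‖r‖ < 1) {w : 𝕜}
    (hw : w ≠ 0) :
    thetaSeries r w = qPochhammer (r ^ 2) (r ^ 2) *
      (qPochhammer (-(r * w)) (r ^ 2) * qPochhammer (-(r / w)) (r ^ 2)) := by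
  have hp := norm_sq_lt_one hr
  obtain ⟨K, hK0, hK⟩ := exists_norm_invPoch_le hp
  have hinv (j : ℤ) : Tendsto (fun n : ℕ => invPoch (r ^ 2) (n + j)) atTop
      (𝓝 (qPochhammer (r ^ 2) (r ^ 2))⁻¹) :=
    (tendsto_invPoch hp).comp (tendsto_atTop_add_const_right _ j tendsto_natCast_atTop_atTop)
  have hseries := tendsto_tsum_mul_of_bounded (l := (atTop : Filter ℕ)) hr w (K := K * K)
    (c := fun n j => invPoch (r ^ 2) (n + j) * invPoch (r ^ 2) (n - j))
    (fun n j => (norm_mul _ _).trans_le (mul_le_mul (hK _) (hK _) (norm_nonneg _) hK0))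
    (fun j => (hinv j).mul (hinv (-j)))
  have hprod := ((tendsto_invPoch hp).comp
    (tendsto_natCast_atTop_atTop.const_mul_atTop' two_pos)).mul
    ((tendsto_prod_range_one_sub_mul_pow hp (-(r * w))).mul
      (tendsto_prod_range_one_sub_mul_pow hp (-(r / w))))
  simp only [← Finset.prod_mul_distrib] at hprod
  have h := tendsto_nhds_unique hseries
    (hprod.congr fun n => (hasSum_finite_triple_product hr0 hr hw n).tsum_eq.symm)
  have hE := qPochhammer_self_ne_zero hp
  field_simp at h
  rw [h, mul_assoc]

end TripleProduct

section AdditionFormula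

variable {𝕜 : Type*} [NormedField 𝕜] {r u v : 𝕜}

theorem thetaSeries_even_term (hr0 : r ≠ 0) (hu : u ≠ 0) (hv : v ≠ 0) (a b : ℤ) :
    ((r ^ 2) ^ (a ^ 2) * (u * v) ^ a) * ((r ^ 2) ^ (b ^ 2) * (u / v) ^ b) =
      (r ^ ((a + b) ^ 2) * u ^ (a + b)) * (r ^ ((a - b) ^ 2) * v ^ (a - b)) := by
  have hpow : r ^ ((a + b) ^ 2) * r ^ ((a - b) ^ 2) = (r ^ 2) ^ (a ^ 2) * (r ^ 2) ^ (b ^ 2) := by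
    rw [← zpow_add₀ hr0, ← zpow_add₀ (pow_ne_zero 2 hr0), ← zpow_natCast r 2, ← zpow_mul]
    congr 1
    push_cast
    ring
  rw [mul_mul_mul_comm, ← hpow, mul_zpow, div_zpow, zpow_add₀ hu, zpow_sub₀ hv]
  ring

theorem thetaSeries_odd_term (hr0 : r ≠ 0) (hu : u ≠ 0) (hv : v ≠ 0) (a b : ℤ) :
    r * u * (((r ^ 2) ^ (a ^ 2) * (r ^ 2 * (u * v)) ^ a) *
        ((r ^ 2) ^ (b ^ 2) * (r ^ 2 * (u / v)) ^ b)) =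
      (r ^ ((a + b + 1) ^ 2) * u ^ (a + b + 1)) * (r ^ ((a - b) ^ 2) * v ^ (a - b)) := by
  have heven := thetaSeries_even_term hr0 hu hv a b
  rw [zpow_add_one_sq hr0, zpow_add_one₀ hu, mul_zpow (r ^ 2), mul_zpow (r ^ 2), sq_zpow r a,
    sq_zpow r b, zpow_add₀ hr0 a b]
  linear_combination (r * u * (r ^ a * r ^ b) ^ 2) * heven

theorem isCompl_range_add_sub :
    IsCompl (range fun x : ℤ × ℤ => (x.1 + x.2, x.1 - x.2))
      (range fun x : ℤ × ℤ => (x.1 + x.2 + 1, x.1 - x.2)) := by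
  constructor
  · rw [Set.disjoint_left]
    rintro _ ⟨⟨a, b⟩, rfl⟩ ⟨⟨c, d⟩, h⟩
    simp only [Prod.mk.injEq] at h
    omega
  · rw [codisjoint_iff_le_sup]
    rintro ⟨m, n⟩ -
    rcases Int.even_or_odd' (m + n) with ⟨k, hk | hk⟩
    · left
      exact ⟨(k, m - k), by simp only [Prod.mk.injEq]; omega⟩
    · right
      exact ⟨(k, m - k - 1), by simp only [Prod.mk.injEq]; omega⟩

theorem injective_add_sub (k : ℤ) :
    Function.Injective fun x : ℤ × ℤ => (x.1 + x.2 + k, x.1 - x.2) := by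
  rintro ⟨a, b⟩ ⟨c, d⟩ h
  simp only [Prod.mk.injEq] at h ⊢
  omega

theorem hasSum_of_isCompl_range {ι α M : Type*} [AddCommMonoid M] [TopologicalSpace M]
    [ContinuousAdd M] {f : α → M} {g₀ g₁ : ι → α} {a b : M}
    (h₀ : Function.Injective g₀) (h₁ : Function.Injective g₁) (h : IsCompl (range g₀) (range g₁))
    (ha : HasSum (fun x => f (g₀ x)) a) (hb : HasSum (fun x => f (g₁ x)) b) :
    HasSum f (a + b) :=
  HasSum.add_isCompl h (h₀.hasSum_range_iff.mpr ha) (h₁.hasSum_range_iff.mpr hb)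

variable [CompleteSpace 𝕜]

theorem hasSum_prod_mul {ι R : Type*} [NormedRing R] [CompleteSpace R] {f g : ι → R}
    (hf : Summable fun n => ‖f n‖) (hg : Summable fun n => ‖g n‖) :
    HasSum (fun x : ι × ι => f x.1 * g x.2) ((∑' n, f n) * ∑' n, g n) := by
  rw [tsum_mul_tsum_of_summable_norm hf hg]
  exact (summable_mul_of_summable_norm hf hg).hasSum

theorem hasSum_thetaSeries_mul (hr : ‖r‖ < 1) (u v : 𝕜) :
    HasSum (fun x : ℤ × ℤ => (r ^ (x.1 ^ 2) * u ^ x.1) * (r ^ (x.2 ^ 2) * v ^ x.2))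
      (thetaSeries r u * thetaSeries r v) :=
  hasSum_prod_mul (f := fun n => r ^ (n ^ 2) * u ^ n) (g := fun n => r ^ (n ^ 2) * v ^ n)
    (summable_norm_thetaSeries hr u) (summable_norm_thetaSeries hr v)

/-- The pairs of indices `(m, n)` with `m + n` even and odd are written as `(a + b, a - b)` and
`(a + b + 1, a - b)`. -/
theorem thetaSeries_mul_thetaSeries (hr0 : r ≠ 0) (hr : ‖r‖ < 1) (hu : u ≠ 0) (hv : v ≠ 0) :
    thetaSeries r u * thetaSeries r v =
      thetaSeries (r ^ 2) (u * v) * thetaSeries (r ^ 2) (u / v) +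
        r * u * (thetaSeries (r ^ 2) (r ^ 2 * (u * v)) *
          thetaSeries (r ^ 2) (r ^ 2 * (u / v))) := by
  have hp := norm_sq_lt_one hr
  have heven := hasSum_thetaSeries_mul hp (u * v) (u / v)
  have hodd := (hasSum_thetaSeries_mul hp (r ^ 2 * (u * v)) (r ^ 2 * (u / v))).mul_left (r * u)
  have hinj : Function.Injective fun x : ℤ × ℤ => (x.1 + x.2, x.1 - x.2) := by
    simpa only [add_zero] using injective_add_sub 0
  refine (hasSum_thetaSeries_mul hr u v).unique (hasSum_of_isCompl_range
    (f := fun x : ℤ × ℤ => (r ^ (x.1 ^ 2) * u ^ x.1) * (r ^ (x.2 ^ 2) * v ^ x.2))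
    hinj (injective_add_sub 1) isCompl_range_add_sub ?_ ?_)
  · exact heven.congr_fun fun x => (thetaSeries_even_term hr0 hu hv x.1 x.2).symm
  · exact hodd.congr_fun fun x => (thetaSeries_odd_term hr0 hu hv x.1 x.2).symm

end AdditionFormula

/-- The theta series `∑ r^(j²) yʲ` with its terms damped by `1 / (r; r)_{n-j}`, which cuts it off
at `j ≤ n`. The eigenvectors of the Jacobi matrix are built from these sequences. -/
noncomputable def partialTheta {𝕜 : Type*} [NormedField 𝕜] (r y : 𝕜) (n : ℤ) : 𝕜 :=
  ∑' j : ℤ, r ^ (j ^ 2) * y ^ j * invPoch r (n - j)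

section PartialTheta

variable {𝕜 : Type*} [NormedField 𝕜] {r : 𝕜}

theorem summable_norm_partialTheta [CompleteSpace 𝕜] (hr : ‖r‖ < 1) (y : 𝕜) (n : ℤ) :
    Summable fun j : ℤ => ‖r ^ (j ^ 2) * y ^ j * invPoch r (n - j)‖ := by
  obtain ⟨K, -, hK⟩ := exists_norm_invPoch_le hr
  refine ((summable_norm_thetaSeries hr y).mul_right K).of_nonneg_of_le
    (fun j => norm_nonneg _) fun j => ?_
  rw [norm_mul]
  exact mul_le_mul_of_nonneg_left (hK _) (norm_nonneg _)

variable [CompleteSpace 𝕜]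

theorem tendsto_partialTheta (hr : ‖r‖ < 1) (y : 𝕜) :
    Tendsto (partialTheta r y) atTop (𝓝 (thetaSeries r y * (qPochhammer r r)⁻¹)) := by
  obtain ⟨K, -, hK⟩ := exists_norm_invPoch_le hr
  refine tendsto_tsum_mul_of_bounded hr y (fun n j => hK (n - j)) fun j => ?_
  exact (tendsto_invPoch hr).comp (tendsto_atTop_add_const_right atTop (-j) tendsto_id)

theorem exists_norm_partialTheta_le (hr : ‖r‖ < 1) (y : 𝕜) :
    ∃ K, ∀ n : ℤ, ‖partialTheta r y n‖ ≤ K := by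
  obtain ⟨K, -, hK⟩ := exists_norm_invPoch_le hr
  refine ⟨∑' j : ℤ, ‖r ^ (j ^ 2) * y ^ j‖ * K, fun n => ?_⟩
  refine tsum_of_norm_bounded ((summable_norm_thetaSeries hr y).mul_right K).hasSum fun j => ?_
  rw [norm_mul]
  exact mul_le_mul_of_nonneg_left (hK _) (norm_nonneg _)

theorem partialTheta_sub_add_one (hr0 : r ≠ 0) (hr : ‖r‖ < 1) {y : 𝕜} (hy : y ≠ 0) (n : ℤ) :
    partialTheta r y n - partialTheta r y (n + 1) =
      -(y * r ^ (n + 1)) * partialTheta r (r * y) n := by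
  rw [partialTheta, partialTheta, ← (summable_norm_partialTheta hr y n).of_norm.tsum_sub
    (summable_norm_partialTheta hr y (n + 1)).of_norm, partialTheta, ← tsum_mul_left,
    ← (Equiv.addRight (1 : ℤ)).tsum_eq]
  refine tsum_congr fun j => ?_
  rw [Equiv.coe_addRight, show n - (j + 1) = n - j - 1 by ring, invPoch_sub_one hr,
    show n + 1 - (j + 1) = n - j by ring, zpow_add_one_sq hr0, zpow_add_one₀ hy, mul_zpow,
    zpow_sub₀ hr0, zpow_add_one₀ hr0]
  field_simp
  ring

theorem partialTheta_sub_sub_one (hr0 : r ≠ 0) (hr : ‖r‖ < 1) (y : 𝕜) (n : ℤ) :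
    partialTheta r (r * y) n - partialTheta r (r * y) (n - 1) = r ^ n * partialTheta r y n := by
  rw [partialTheta, partialTheta, ← (summable_norm_partialTheta hr (r * y) n).of_norm.tsum_sub
    (summable_norm_partialTheta hr (r * y) (n - 1)).of_norm, partialTheta, ← tsum_mul_left]
  refine tsum_congr fun j => ?_
  rw [sub_right_comm, invPoch_sub_one hr, mul_zpow, zpow_sub₀ hr0]
  field_simp
  ring

theorem exists_norm_zpow_mul_partialTheta_le (hr0 : r ≠ 0) (hr : ‖r‖ < 1) (y : 𝕜) :
    ∃ K, ∀ n : ℤ, ‖r ^ n * partialTheta r y n‖ ≤ K := by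
  obtain ⟨K, hK⟩ := exists_norm_partialTheta_le hr (r * y)
  refine ⟨K + K, fun n => ?_⟩
  rw [← partialTheta_sub_sub_one hr0 hr]
  exact norm_sub_le_of_le (hK n) (hK (n - 1))

end PartialTheta

section Differentiability

theorem ofReal_thetaSeries (r w : ℝ) : ((thetaSeries r w : ℝ) : ℂ) = thetaSeries (r : ℂ) w := by
  simp only [thetaSeries, Complex.ofReal_tsum, Complex.ofReal_mul, Complex.ofReal_zpow]

theorem thetaSeries_exp_eq_jacobiTheta₂ (z τ : ℂ) :
    thetaSeries (Complex.exp (Real.pi * Complex.I * τ)) (Complex.exp (2 * Real.pi * Complex.I * z))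
      = jacobiTheta₂ z τ := by
  refine tsum_congr fun n => ?_
  rw [jacobiTheta₂_term, Complex.exp_add, ← Complex.exp_int_mul, ← Complex.exp_int_mul, mul_comm]
  congr 2
  · ring
  · push_cast; ring

theorem differentiableAt_thetaSeries {r w : ℂ} (hr0 : r ≠ 0) (hr : ‖r‖ < 1) (hw : w ≠ 0) :
    DifferentiableAt ℂ (thetaSeries r) w := by
  have hpi : (Real.pi : ℂ) ≠ 0 := mod_cast Real.pi_ne_zero
  set τ := -(Complex.I * Complex.log r) / Real.pi with hτ
  have him : 0 < τ.im := by
    rw [hτ, Complex.div_ofReal_im, Complex.neg_im, Complex.I_mul_im, Complex.log_re]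
    exact div_pos (neg_pos.mpr (Real.log_neg (norm_pos_iff.mpr hr0) hr)) Real.pi_pos
  have hexp : Complex.exp (Real.pi * Complex.I * τ) = r := by
    rw [hτ, show Real.pi * Complex.I * (-(Complex.I * Complex.log r) / Real.pi) =
      -(Complex.I * Complex.I) * Complex.log r by field_simp, Complex.I_mul_I, neg_neg, one_mul,
      Complex.exp_log hr0]
  -- a branch of the logarithm that is holomorphic near `w`
  set L : ℂ → ℂ := fun v => (Complex.log w + Complex.log (v / w)) / (2 * Real.pi * Complex.I)
  have hL : DifferentiableAt ℂ L w := by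
    have hslit : w / w ∈ Complex.slitPlane := by rw [div_self hw]; exact Complex.one_mem_slitPlane
    fun_prop (disch := assumption)
  refine ((differentiableAt_jacobiTheta₂_fst (L w) him).comp w hL).congr_of_eventuallyEq ?_
  filter_upwards [isOpen_ne.mem_nhds hw] with v hv
  have hLv : Complex.exp (2 * Real.pi * Complex.I * L v) = v := by
    rw [mul_div_cancel₀ _ (by simp [hpi]), Complex.exp_add, Complex.exp_log hw,
      Complex.exp_log (div_ne_zero hv hw), mul_div_cancel₀ _ hw]
  rw [Function.comp_apply, ← thetaSeries_exp_eq_jacobiTheta₂, hexp, hLv]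

theorem differentiableAt_thetaSeries_real {r w : ℝ} (hr0 : 0 < r) (hr1 : r < 1) (hw : w ≠ 0) :
    DifferentiableAt ℝ (thetaSeries r) w := by
  have h : DifferentiableAt ℂ (thetaSeries (r : ℂ)) w :=
    differentiableAt_thetaSeries (mod_cast hr0.ne') (by simpa [abs_of_pos hr0] using hr1)
      (mod_cast hw)
  simpa only [← ofReal_thetaSeries, Complex.ofReal_re] using
    h.hasDerivAt.real_of_complex.differentiableAt

end Differentiability

/-- The function `-i r^(-1/4) ϑ₁(i s ∣ r)` on the real line. -/
noncomputable def realThetaOne (r s : ℝ) : ℝ :=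
  Real.exp s * thetaSeries r (-(r * Real.exp s ^ 2))

/-- The function `r^(-1/4) ϑ₂(i s ∣ r)` on the real line. -/
noncomputable def realThetaTwo (r s : ℝ) : ℝ :=
  Real.exp s * thetaSeries r (r * Real.exp s ^ 2)

/-- The function `ϑ₃(i s ∣ r)` on the real line. -/
noncomputable def realThetaThree (r s : ℝ) : ℝ := thetaSeries r (Real.exp s ^ 2)

/-- The function `ϑ₄(i s ∣ r)` on the real line. -/
noncomputable def realThetaFour (r s : ℝ) : ℝ := thetaSeries r (-Real.exp s ^ 2)

section RealTheta

variable {r : ℝ}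

theorem thetaSeries_pos (hr0 : 0 < r) (hr1 : r < 1) {w : ℝ} (hw : 0 < w) :
    0 < thetaSeries r w :=
  (hasSum_thetaSeries (by rwa [Real.norm_of_nonneg hr0.le]) w).summable.tsum_pos
    (fun n => by positivity) 0 (by positivity)

theorem realThetaTwo_pos (hr0 : 0 < r) (hr1 : r < 1) (s : ℝ) : 0 < realThetaTwo r s :=
  mul_pos (Real.exp_pos _) (thetaSeries_pos hr0 hr1 (by positivity))

theorem realThetaThree_pos (hr0 : 0 < r) (hr1 : r < 1) (s : ℝ) : 0 < realThetaThree r s :=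
  thetaSeries_pos hr0 hr1 (by positivity)

theorem differentiable_realThetaOne (hr0 : 0 < r) (hr1 : r < 1) :
    Differentiable ℝ (realThetaOne r) := fun s =>
  have hw : -(r * Real.exp s ^ 2) ≠ 0 := by simp [hr0.ne']
  Real.differentiableAt_exp.mul <|
    (differentiableAt_thetaSeries_real hr0 hr1 hw).fun_comp' s (by fun_prop)

theorem differentiable_realThetaFour (hr0 : 0 < r) (hr1 : r < 1) :
    Differentiable ℝ (realThetaFour r) := fun s =>
  have hw : -Real.exp s ^ 2 ≠ 0 := by simp
  DifferentiableAt.fun_comp' (f := fun s => -Real.exp s ^ 2) s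
    (differentiableAt_thetaSeries_real hr0 hr1 hw) (by fun_prop)

theorem realThetaOne_add_log (hr0 : 0 < r) (s : ℝ) :
    realThetaOne r (s + Real.log r) = -(r * Real.exp s ^ 2)⁻¹ * realThetaOne r s := by
  rw [realThetaOne, realThetaOne, Real.exp_add, Real.exp_log hr0,
    ← thetaSeries_sq_mul hr0.ne' (w := -(r * Real.exp s ^ 2)) (by simp [hr0.ne']),
    show r ^ 2 * -(r * Real.exp s ^ 2) = -(r * (Real.exp s * r) ^ 2) by ring]
  field_simp

theorem realThetaFour_add_log (hr0 : 0 < r) (s : ℝ) :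
    realThetaFour r (s + Real.log r) = -(r * Real.exp s ^ 2)⁻¹ * realThetaFour r s := by
  rw [realThetaFour, realThetaFour, Real.exp_add, Real.exp_log hr0,
    ← thetaSeries_sq_mul hr0.ne' (w := -Real.exp s ^ 2) (by simp),
    show r ^ 2 * -Real.exp s ^ 2 = -(Real.exp s * r) ^ 2 by ring]
  field_simp

theorem realThetaOne_neg (hr0 : 0 < r) (s : ℝ) : realThetaOne r (-s) = -realThetaOne r s := by
  rw [realThetaOne, realThetaOne, ← thetaSeries_inv r (-(r * Real.exp s ^ 2)),
    ← thetaSeries_sq_mul hr0.ne' (w := (-(r * Real.exp s ^ 2))⁻¹) (by simp [hr0.ne']),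
    show r ^ 2 * (-(r * Real.exp s ^ 2))⁻¹ = -(r * Real.exp (-s) ^ 2) by
      rw [Real.exp_neg]; field_simp, Real.exp_neg]
  field_simp

theorem realThetaFour_neg (s : ℝ) : realThetaFour r (-s) = realThetaFour r s := by
  rw [realThetaFour, realThetaFour, Real.exp_neg, inv_pow, ← inv_neg, thetaSeries_inv]

theorem realThetaOne_zero (hr0 : 0 < r) : realThetaOne r 0 = 0 := by
  have h := realThetaOne_neg hr0 0
  rw [neg_zero] at h
  linarith

theorem realThetaOne_eq_qPochhammer (hr0 : 0 < r) (hr1 : r < 1) (s : ℝ) :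
    realThetaOne r s = (Real.exp s - (Real.exp s)⁻¹) * (qPochhammer (r ^ 2) (r ^ 2) *
      (qPochhammer (r ^ 2 * Real.exp s ^ 2) (r ^ 2) *
        qPochhammer (r ^ 2 * (Real.exp s ^ 2)⁻¹) (r ^ 2))) := by
  have hr : ‖r‖ < 1 := by rwa [Real.norm_of_nonneg hr0.le]
  rw [realThetaOne, thetaSeries_eq_triple_product hr0.ne' hr (by simp [hr0.ne']),
    show -(r * -(r * Real.exp s ^ 2)) = r ^ 2 * Real.exp s ^ 2 by ring,
    show -(r / -(r * Real.exp s ^ 2)) = (Real.exp s ^ 2)⁻¹ by field_simp,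
    qPochhammer_eq_one_sub_mul (norm_sq_lt_one hr) (Real.exp s ^ 2)⁻¹, mul_comm _ (r ^ 2)]
  field_simp

theorem realThetaOne_pos (hr0 : 0 < r) (hr1 : r < 1) {s : ℝ} (hs0 : 0 < s)
    (hs1 : s < -Real.log r) : 0 < realThetaOne r s := by
  have hp0 : 0 ≤ r ^ 2 := sq_nonneg r
  have hp1 : r ^ 2 < 1 := pow_lt_one₀ hr0.le hr1 two_ne_zero
  have hexp : 1 < Real.exp s := Real.one_lt_exp_iff.mpr hs0
  have hinv : (Real.exp s)⁻¹ < 1 := inv_lt_one_of_one_lt₀ hexp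
  have hmul : r * Real.exp s < 1 := by
    rw [← Real.exp_log hr0, ← Real.exp_add, Real.exp_lt_one_iff]
    linarith
  rw [realThetaOne_eq_qPochhammer hr0 hr1]
  refine mul_pos (by linarith) (mul_pos (qPochhammer_pos hp0 hp1 hp1)
    (mul_pos (qPochhammer_pos hp0 hp1 ?_) (qPochhammer_pos hp0 hp1 ?_)))
  · rw [← mul_pow]
    exact pow_lt_one₀ (by positivity) hmul two_ne_zero
  · rw [← inv_pow, ← mul_pow]
    exact pow_lt_one₀ (by positivity) (mul_lt_one_of_nonneg_of_lt_one_left hr0.le hr1 hinv.le)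
      two_ne_zero

theorem realThetaFour_zero_pos (hr0 : 0 < r) (hr1 : r < 1) : 0 < realThetaFour r 0 := by
  have hr : ‖r‖ < 1 := by rwa [Real.norm_of_nonneg hr0.le]
  have hp0 : 0 ≤ r ^ 2 := sq_nonneg r
  have hp1 : r ^ 2 < 1 := pow_lt_one₀ hr0.le hr1 two_ne_zero
  rw [realThetaFour, thetaSeries_eq_triple_product hr0.ne' hr (by simp)]
  refine mul_pos (qPochhammer_pos hp0 hp1 hp1)
    (mul_pos (qPochhammer_pos hp0 hp1 ?_) (qPochhammer_pos hp0 hp1 ?_)) <;>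
    simpa [div_neg] using hr1

end RealTheta

section Duplication

variable {r : ℝ}

theorem thetaSeries_sq (hr0 : r ≠ 0) (hr : ‖r‖ < 1) {u : ℝ} (hu : u ≠ 0) :
    thetaSeries r u ^ 2 = thetaSeries (r ^ 2) (u ^ 2) * thetaSeries (r ^ 2) 1 +
      r * u * (thetaSeries (r ^ 2) (r ^ 2 * u ^ 2) * thetaSeries (r ^ 2) (r ^ 2)) := by
  rw [sq, thetaSeries_mul_thetaSeries hr0 hr hu hu, div_self hu, ← sq, mul_one]

theorem realThetaThree_sq (hr0 : r ≠ 0) (hr : ‖r‖ < 1) (s : ℝ) :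
    realThetaThree r s ^ 2 = realThetaThree (r ^ 2) (2 * s) * realThetaThree (r ^ 2) 0 +
      r * (realThetaTwo (r ^ 2) (2 * s) * realThetaTwo (r ^ 2) 0) := by
  simp only [realThetaThree, realThetaTwo, two_mul, Real.exp_add, Real.exp_zero,
    thetaSeries_sq hr0 hr (pow_ne_zero 2 (Real.exp_ne_zero s))]
  ring_nf

theorem realThetaFour_sq (hr0 : r ≠ 0) (hr : ‖r‖ < 1) (s : ℝ) :
    realThetaFour r s ^ 2 = realThetaThree (r ^ 2) (2 * s) * realThetaThree (r ^ 2) 0 -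
      r * (realThetaTwo (r ^ 2) (2 * s) * realThetaTwo (r ^ 2) 0) := by
  simp only [realThetaThree, realThetaTwo, realThetaFour, two_mul, Real.exp_add, Real.exp_zero,
    thetaSeries_sq hr0 hr (neg_ne_zero.mpr (pow_ne_zero 2 (Real.exp_ne_zero s)))]
  ring_nf

theorem realThetaTwo_sq (hr0 : r ≠ 0) (hr : ‖r‖ < 1) (s : ℝ) :
    realThetaTwo r s ^ 2 = realThetaTwo (r ^ 2) (2 * s) * realThetaThree (r ^ 2) 0 +
      realThetaThree (r ^ 2) (2 * s) * realThetaTwo (r ^ 2) 0 := by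
  have hx := Real.exp_ne_zero s
  have hshift := thetaSeries_sq_mul (pow_ne_zero 2 hr0) (w := Real.exp s ^ 4) (pow_ne_zero 4 hx)
  simp only [realThetaThree, realThetaTwo, two_mul, Real.exp_add, Real.exp_zero, mul_pow _ _ 2,
    thetaSeries_sq hr0 hr (mul_ne_zero hr0 (pow_ne_zero 2 hx))]
  ring_nf at hshift ⊢
  linear_combination thetaSeries (r ^ 2) (r ^ 2) * hshift

theorem realThetaOne_sq (hr0 : r ≠ 0) (hr : ‖r‖ < 1) (s : ℝ) :
    realThetaOne r s ^ 2 = realThetaTwo (r ^ 2) (2 * s) * realThetaThree (r ^ 2) 0 -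
      realThetaThree (r ^ 2) (2 * s) * realThetaTwo (r ^ 2) 0 := by
  have hx := Real.exp_ne_zero s
  have hshift := thetaSeries_sq_mul (pow_ne_zero 2 hr0) (w := Real.exp s ^ 4) (pow_ne_zero 4 hx)
  simp only [realThetaThree, realThetaTwo, realThetaOne, two_mul, Real.exp_add, Real.exp_zero,
    mul_pow _ _ 2, thetaSeries_sq hr0 hr (neg_ne_zero.mpr (mul_ne_zero hr0 (pow_ne_zero 2 hx)))]
  ring_nf at hshift ⊢
  linear_combination -thetaSeries (r ^ 2) (r ^ 2) * hshift

theorem realThetaThree_zero_pow_four (hr0 : r ≠ 0) (hr : ‖r‖ < 1) :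
    realThetaThree r 0 ^ 4 = r * realThetaTwo r 0 ^ 4 + realThetaFour r 0 ^ 4 := by
  simp only [pow_mul _ 2 2, show 4 = 2 * 2 from rfl, realThetaTwo_sq hr0 hr,
    realThetaThree_sq hr0 hr, realThetaFour_sq hr0 hr, mul_zero]
  ring

theorem realThetaFour_zero_sq_mul_realThetaTwo_sq (hr0 : r ≠ 0) (hr : ‖r‖ < 1) (s : ℝ) :
    realThetaFour r 0 ^ 2 * realThetaTwo r s ^ 2 =
      realThetaTwo r 0 ^ 2 * realThetaFour r s ^ 2 +
        realThetaThree r 0 ^ 2 * realThetaOne r s ^ 2 := by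
  simp only [realThetaOne_sq hr0 hr, realThetaTwo_sq hr0 hr, realThetaThree_sq hr0 hr,
    realThetaFour_sq hr0 hr, mul_zero]
  ring

theorem realThetaFour_zero_sq_mul_realThetaThree_sq (hr0 : r ≠ 0) (hr : ‖r‖ < 1) (s : ℝ) :
    realThetaFour r 0 ^ 2 * realThetaThree r s ^ 2 =
      realThetaThree r 0 ^ 2 * realThetaFour r s ^ 2 +
        r * realThetaTwo r 0 ^ 2 * realThetaOne r s ^ 2 := by
  simp only [realThetaOne_sq hr0 hr, realThetaTwo_sq hr0 hr, realThetaThree_sq hr0 hr,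
    realThetaFour_sq hr0 hr, mul_zero]
  ring

end Duplication

/-- The theta function with characteristic `1/4`: up to the factor `r^(1/8)` it is the series
`∑ r^(2(n + 1/4)²) e^(4(n + 1/4)s)`. The products `ϑ₁(x) ϑ₄(y)` and `ϑ₂(x) ϑ₃(x)` are bilinear in
it. -/
noncomputable def quarterTheta (r s : ℝ) : ℝ :=
  Real.exp s * thetaSeries (r ^ 2) (r * Real.exp s ^ 4)

section Wronskian

variable {r : ℝ}

theorem quarterTheta_zero_pos (hr0 : 0 < r) (hr1 : r < 1) : 0 < quarterTheta r 0 :=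
  mul_pos (Real.exp_pos _) (thetaSeries_pos (pow_pos hr0 2) (pow_lt_one₀ hr0.le hr1 two_ne_zero)
    (by positivity))

theorem differentiable_quarterTheta (hr0 : 0 < r) (hr1 : r < 1) :
    Differentiable ℝ (quarterTheta r) := fun s =>
  have hw : r * Real.exp s ^ 4 ≠ 0 := by simp [hr0.ne']
  Real.differentiableAt_exp.mul <| (differentiableAt_thetaSeries_real (pow_pos hr0 2)
    (pow_lt_one₀ hr0.le hr1 two_ne_zero) hw).fun_comp' s (by fun_prop)

theorem thetaSeries_cube_mul (hr0 : r ≠ 0) (s : ℝ) :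
    r * Real.exp s ^ 3 * thetaSeries (r ^ 2) (r ^ 2 * (r * Real.exp s ^ 4)) =
      quarterTheta r (-s) := by
  have hw : r⁻¹ * Real.exp s ^ 4 ≠ 0 := by simp [hr0]
  have h := thetaSeries_sq_mul (pow_ne_zero 2 hr0) hw
  rw [← thetaSeries_inv _ (r⁻¹ * Real.exp s ^ 4),
    show (r⁻¹ * Real.exp s ^ 4)⁻¹ = r * Real.exp (-s) ^ 4 by rw [Real.exp_neg]; field_simp,
    show (r ^ 2) ^ 2 * (r⁻¹ * Real.exp s ^ 4) = r ^ 2 * (r * Real.exp s ^ 4) by field_simp] at h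
  rw [quarterTheta, ← h, Real.exp_neg]
  field_simp

theorem realThetaOne_mul_realThetaFour (hr0 : r ≠ 0) (hr : ‖r‖ < 1) (s y : ℝ) :
    realThetaOne r (s + y) * realThetaFour r (s - y) =
      quarterTheta r s * quarterTheta r y - quarterTheta r (-s) * quarterTheta r (-y) := by
  have hs := Real.exp_ne_zero s
  have hy := Real.exp_ne_zero y
  rw [← thetaSeries_cube_mul hr0 s, ← thetaSeries_cube_mul hr0 y, realThetaOne, realThetaFour,
    Real.exp_add, Real.exp_sub, mul_assoc,
    thetaSeries_mul_thetaSeries hr0 hr (by simp [hr0]) (by simp),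
    show -(r * (Real.exp s * Real.exp y) ^ 2) * -(Real.exp s / Real.exp y) ^ 2 =
      r * Real.exp s ^ 4 by field_simp,
    show -(r * (Real.exp s * Real.exp y) ^ 2) / -(Real.exp s / Real.exp y) ^ 2 =
      r * Real.exp y ^ 4 by field_simp, quarterTheta, quarterTheta]
  ring

theorem realThetaTwo_mul_realThetaThree (hr0 : r ≠ 0) (hr : ‖r‖ < 1) (s : ℝ) :
    realThetaTwo r s * realThetaThree r s =
      quarterTheta r 0 * (quarterTheta r s + quarterTheta r (-s)) := by
  have hs := Real.exp_ne_zero s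
  have h₀ := thetaSeries_cube_mul hr0 0
  rw [neg_zero, quarterTheta, Real.exp_zero, one_pow, one_pow, mul_one, one_mul] at h₀
  rw [← thetaSeries_cube_mul hr0 s, realThetaTwo, realThetaThree, mul_assoc,
    thetaSeries_mul_thetaSeries hr0 hr (by simp [hr0]) (by simp),
    show r * Real.exp s ^ 2 * Real.exp s ^ 2 = r * Real.exp s ^ 4 by ring,
    mul_div_cancel_right₀ r (pow_ne_zero 2 hs), quarterTheta, quarterTheta, Real.exp_zero,
    one_pow, mul_one]
  linear_combination (r * Real.exp s ^ 3 * thetaSeries (r ^ 2) (r ^ 2 * (r * Real.exp s ^ 4))) * h₀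

theorem realThetaTwo_mul_realThetaThree_mul_realThetaFour_zero (hr0 : r ≠ 0) (hr : ‖r‖ < 1) :
    realThetaTwo r 0 * realThetaThree r 0 * realThetaFour r 0 =
      2 * qPochhammer (r ^ 2) (r ^ 2) ^ 3 := by
  have hp := norm_sq_lt_one hr
  have hone := qPochhammer_eq_one_sub_mul hp (-1)
  have heuler := qPochhammer_neg_self_mul_qPochhammer_sq hr
  rw [← qPochhammer_sq_mul_qPochhammer_sq hr (-r), neg_mul, ← sq] at heuler
  simp only [realThetaTwo, realThetaThree, realThetaFour, Real.exp_zero, one_pow, mul_one, one_mul,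
    thetaSeries_eq_triple_product hr0 hr hr0, thetaSeries_eq_triple_product hr0 hr one_ne_zero,
    thetaSeries_eq_triple_product hr0 hr (neg_ne_zero.mpr one_ne_zero), div_self hr0, div_one,
    mul_neg, neg_neg, div_neg, hone, ← sq, neg_mul]
  linear_combination (2 * qPochhammer (r ^ 2) (r ^ 2) ^ 3) * (qPochhammer (-r) (r ^ 2) *
    qPochhammer (-r ^ 2) (r ^ 2) * qPochhammer r (r ^ 2) + 1) * heuler

theorem hasDerivAt_realThetaOne_zero (hr0 : 0 < r) (hr1 : r < 1) :
    HasDerivAt (realThetaOne r) (realThetaTwo r 0 * realThetaThree r 0 * realThetaFour r 0) 0 := by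
  have hr : ‖r‖ < 1 := by rwa [Real.norm_of_nonneg hr0.le]
  set g : ℝ → ℝ := fun s => qPochhammer (r ^ 2) (r ^ 2) *
    (qPochhammer (r ^ 2 * Real.exp s ^ 2) (r ^ 2) *
      qPochhammer (r ^ 2 * (Real.exp s ^ 2)⁻¹) (r ^ 2)) with hg
  have hcont : ContinuousAt g 0 := by
    have h := continuous_qPochhammer_left (norm_sq_lt_one hr)
    have hinv : ContinuousAt (fun s => r ^ 2 * (Real.exp s ^ 2)⁻¹) 0 := by
      fun_prop (disch := simp)
    exact continuousAt_const.mul ((by fun_prop : ContinuousAt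
      (fun s => qPochhammer (r ^ 2 * Real.exp s ^ 2) (r ^ 2)) 0).mul (h.continuousAt.comp hinv))
  have hsinh : HasDerivAt (fun s : ℝ => Real.exp s - (Real.exp s)⁻¹) 2 0 := by
    have h := (Real.hasDerivAt_exp 0).sub ((Real.hasDerivAt_exp 0).inv (Real.exp_ne_zero 0))
    norm_num at h
    exact h
  have hg0 : g 0 = qPochhammer (r ^ 2) (r ^ 2) ^ 3 := by
    simp only [hg, Real.exp_zero, one_pow, inv_one, mul_one]
    ring
  rw [realThetaTwo_mul_realThetaThree_mul_realThetaFour_zero hr0.ne' hr, ← hg0,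
    hasDerivAt_iff_tendsto_slope]
  refine ((hasDerivAt_iff_tendsto_slope.mp hsinh).mul
    (hcont.tendsto.mono_left nhdsWithin_le_nhds)).congr fun s => ?_
  rw [slope_def_field, slope_def_field, realThetaOne_zero hr0, realThetaOne_eq_qPochhammer hr0 hr1]
  simp only [Real.exp_zero, inv_one, sub_self, sub_zero, hg]
  ring

theorem deriv_quarterTheta_mul (hr0 : 0 < r) (hr1 : r < 1) (s : ℝ) :
    deriv (quarterTheta r) 0 * (realThetaTwo r s * realThetaThree r s) =
      (deriv (realThetaOne r) s * realThetaFour r s -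
        realThetaOne r s * deriv (realThetaFour r) s) * quarterTheta r 0 := by
  have hr : ‖r‖ < 1 := by rwa [Real.norm_of_nonneg hr0.le]
  have h₁ := (differentiable_realThetaOne hr0 hr1 (s + 0)).hasDerivAt.comp_const_add s 0
  have h₄ := (differentiable_realThetaFour hr0 hr1 (s - 0)).hasDerivAt.comp_const_sub s 0
  have hN := (differentiable_quarterTheta hr0 hr1 0).hasDerivAt
  have hN' := (differentiable_quarterTheta hr0 hr1 (-0)).hasDerivAt.comp (0 : ℝ) (hasDerivAt_neg 0)
  have h := (h₁.mul h₄).unique (((hN.const_mul (quarterTheta r s)).sub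
    (hN'.const_mul (quarterTheta r (-s)))).congr_of_eventuallyEq (Eventually.of_forall fun y =>
      realThetaOne_mul_realThetaFour hr0.ne' hr s y))
  simp only [add_zero, sub_zero, neg_zero] at h
  rw [realThetaTwo_mul_realThetaThree hr0.ne' hr]
  linear_combination -quarterTheta r 0 * h

/-- By differentiating the addition formula for `ϑ₁(s + y) ϑ₄(s - y)` at `y = 0`, the Wronskian is a
constant multiple of `ϑ₂ϑ₃`; the constant is found at `s = 0`. -/
theorem realTheta_wronskian (hr0 : 0 < r) (hr1 : r < 1) (s : ℝ) :
    deriv (realThetaOne r) s * realThetaFour r s - realThetaOne r s * deriv (realThetaFour r) s =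
      realThetaFour r 0 ^ 2 * (realThetaTwo r s * realThetaThree r s) := by
  have hN := (quarterTheta_zero_pos hr0 hr1).ne'
  have h₂₃ := (mul_pos (realThetaTwo_pos hr0 hr1 0) (realThetaThree_pos hr0 hr1 0)).ne'
  have hconst : deriv (quarterTheta r) 0 = realThetaFour r 0 ^ 2 * quarterTheta r 0 := by
    have h₀ := deriv_quarterTheta_mul hr0 hr1 0
    rw [(hasDerivAt_realThetaOne_zero hr0 hr1).deriv, realThetaOne_zero hr0] at h₀
    refine mul_right_cancel₀ h₂₃ ?_
    linear_combination h₀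
  have hs := deriv_quarterTheta_mul hr0 hr1 s
  rw [hconst] at hs
  refine mul_right_cancel₀ hN ?_
  linear_combination -hs

end Wronskian

/-- The quotient `ϑ₄ / ϑ₁` on the imaginary axis, normalized so as to be real; it is `Φ` when the
nome is `r = q²`. -/
noncomputable def thetaRatio (r s : ℝ) : ℝ := realThetaFour r s / realThetaOne r s

section ThetaRatio

variable {r : ℝ}

theorem thetaRatio_neg (hr0 : 0 < r) (s : ℝ) : thetaRatio r (-s) = -thetaRatio r s := by
  rw [thetaRatio, thetaRatio, realThetaFour_neg, realThetaOne_neg hr0, div_neg]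

theorem thetaRatio_add_log (hr0 : 0 < r) (s : ℝ) :
    thetaRatio r (s + Real.log r) = thetaRatio r s := by
  have h : -(r * Real.exp s ^ 2)⁻¹ ≠ 0 := by simp [hr0.ne']
  rw [thetaRatio, thetaRatio, realThetaFour_add_log hr0, realThetaOne_add_log hr0,
    mul_div_mul_left _ _ h]

theorem thetaRatio_neg_log_sub (hr0 : 0 < r) (s : ℝ) :
    thetaRatio r (-Real.log r - s) = -thetaRatio r s := by
  rw [← thetaRatio_add_log hr0, ← thetaRatio_neg hr0]
  ring_nf

theorem hasDerivAt_thetaRatio (hr0 : 0 < r) (hr1 : r < 1) {s : ℝ} (hs : realThetaOne r s ≠ 0) :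
    HasDerivAt (thetaRatio r) (-(realThetaFour r 0 ^ 2 * (realThetaTwo r s * realThetaThree r s) /
      realThetaOne r s ^ 2)) s := by
  refine ((differentiable_realThetaFour hr0 hr1 s).hasDerivAt.div
    (differentiable_realThetaOne hr0 hr1 s).hasDerivAt hs).congr_deriv ?_
  rw [← realTheta_wronskian hr0 hr1 s]
  ring

theorem tendsto_thetaRatio_atTop (hr0 : 0 < r) (hr1 : r < 1) :
    Tendsto (thetaRatio r) (𝓝[>] 0) atTop := by
  have hL : 0 < -Real.log r := neg_pos.mpr (Real.log_neg hr0 hr1)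
  have h₄ : Tendsto (realThetaFour r) (𝓝[>] 0) (𝓝 (realThetaFour r 0)) :=
    (differentiable_realThetaFour hr0 hr1).continuous.continuousWithinAt
  have h₁ : Tendsto (realThetaOne r) (𝓝[>] 0) (𝓝 0) := by
    simpa only [realThetaOne_zero hr0] using
      ((differentiable_realThetaOne hr0 hr1).continuous.tendsto 0).mono_left nhdsWithin_le_nhds
  have h₁pos : ∀ᶠ s in 𝓝[>] 0, 0 < realThetaOne r s := by
    filter_upwards [Ioo_mem_nhdsGT hL] with s hs using realThetaOne_pos hr0 hr1 hs.1 hs.2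
  exact h₄.pos_mul_atTop (realThetaFour_zero_pos hr0 hr1)
    (tendsto_inv_nhdsGT_zero.comp (tendsto_nhdsWithin_iff.mpr ⟨h₁, h₁pos⟩))

theorem continuousOn_thetaRatio (hr0 : 0 < r) (hr1 : r < 1) :
    ContinuousOn (thetaRatio r) (Ioo 0 (-Real.log r)) :=
  HasDerivAt.continuousOn fun _ hs =>
    hasDerivAt_thetaRatio hr0 hr1 (realThetaOne_pos hr0 hr1 hs.1 hs.2).ne'

theorem strictAntiOn_thetaRatio (hr0 : 0 < r) (hr1 : r < 1) :
    StrictAntiOn (thetaRatio r) (Ioo 0 (-Real.log r)) := by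
  refine strictAntiOn_of_deriv_neg (convex_Ioo _ _) (continuousOn_thetaRatio hr0 hr1) fun s hs => ?_
  rw [interior_Ioo] at hs
  have h₁ := realThetaOne_pos hr0 hr1 hs.1 hs.2
  have h₂ := realThetaTwo_pos hr0 hr1 s
  have h₃ := realThetaThree_pos hr0 hr1 s
  have h₄ := realThetaFour_zero_pos hr0 hr1
  rw [(hasDerivAt_thetaRatio hr0 hr1 h₁.ne').deriv, neg_lt_zero]
  positivity

theorem surjOn_thetaRatio (hr0 : 0 < r) (hr1 : r < 1) :
    SurjOn (thetaRatio r) (Ioo 0 (-Real.log r)) univ := by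
  intro t _
  have hL : 0 < -Real.log r := neg_pos.mpr (Real.log_neg hr0 hr1)
  have hlarge (y : ℝ) : ∃ s ∈ Ioo 0 (-Real.log r), y ≤ thetaRatio r s :=
    ((eventually_mem_set.mpr (Ioo_mem_nhdsGT hL)).and
      ((tendsto_thetaRatio_atTop hr0 hr1).eventually_ge_atTop y)).exists
  obtain ⟨s₁, hs₁, h₁⟩ := hlarge t
  obtain ⟨s₂, hs₂, h₂⟩ := hlarge (-t)
  have hs₂' : -Real.log r - s₂ ∈ Ioo 0 (-Real.log r) :=
    ⟨sub_pos.mpr hs₂.2, sub_lt_self _ hs₂.1⟩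
  refine isPreconnected_Ioo.intermediate_value hs₂' hs₁ (continuousOn_thetaRatio hr0 hr1) ⟨?_, h₁⟩
  rw [thetaRatio_neg_log_sub hr0]
  linarith

end ThetaRatio

/-- The integrand `((a + x²)(b + x²))^(-1/2)` of an elliptic integral of the first kind. -/
noncomputable def ellipticWeight (a b x : ℝ) : ℝ := (√((a + x ^ 2) * (b + x ^ 2)))⁻¹

section EllipticIntegral

open MeasureTheory

theorem ellipticWeight_pos {a b : ℝ} (ha : 0 < a) (hb : 0 < b) (x : ℝ) :
    0 < ellipticWeight a b x := by
  unfold ellipticWeight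
  positivity

theorem continuous_ellipticWeight {a b : ℝ} (ha : 0 < a) (hb : 0 < b) :
    Continuous (ellipticWeight a b) :=
  Continuous.inv₀ (by fun_prop) fun x => by positivity

theorem integrable_ellipticWeight {a b : ℝ} (ha : 0 < a) (hb : 0 < b) :
    Integrable (ellipticWeight a b) := by
  set c := min (min a b) 1
  have hc0 : 0 < c := lt_min (lt_min ha hb) one_pos
  have hca : c ≤ a := (min_le_left _ _).trans (min_le_left _ _)
  have hcb : c ≤ b := (min_le_left _ _).trans (min_le_right _ _)
  have hc1 : c ≤ 1 := min_le_right _ _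
  refine (integrable_inv_one_add_sq.const_mul c⁻¹).mono'
    (continuous_ellipticWeight ha hb).aestronglyMeasurable (Eventually.of_forall fun x => ?_)
  have hle : c * (1 + x ^ 2) ≤ √((a + x ^ 2) * (b + x ^ 2)) := by
    refine Real.le_sqrt_of_sq_le ?_
    rw [sq]
    refine mul_le_mul ?_ ?_ (by positivity) (by positivity) <;> nlinarith [sq_nonneg x]
  rw [Real.norm_of_nonneg (ellipticWeight_pos ha hb x).le, ← mul_inv]
  exact inv_anti₀ (mul_pos hc0 (by positivity)) hle

/-- Separation of variables: `s + ∫₀^{y(s)} f` is constant along solutions of `y' = -1 / f(y)`. -/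
theorem integral_Ioi_eq_of_hasDerivAt_neg_inv {f y : ℝ → ℝ} {L : ℝ} (hf : Integrable f)
    (hcont : Continuous f) (hne : ∀ x, f x ≠ 0)
    (hy : ∀ s ∈ Ioo 0 L, HasDerivAt y (-(f (y s))⁻¹) s) (hlim : Tendsto y (𝓝[>] 0) atTop)
    {s : ℝ} (hs : s ∈ Ioo 0 L) : ∫ x in Ioi (y s), f x = s := by
  set F : ℝ → ℝ := fun s => (∫ x in (0 : ℝ)..y s, f x) + s
  have hderiv (s) (hs : s ∈ Ioo 0 L) : HasDerivAt F 0 s := by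
    refine (((hcont.integral_hasStrictDerivAt 0 (y s)).hasDerivAt.comp s (hy s hs)).add
      (hasDerivAt_id s)).congr_deriv ?_
    rw [mul_neg, mul_inv_cancel₀ (hne _), neg_add_cancel]
  obtain ⟨c, hc⟩ := isOpen_Ioo.exists_is_const_of_deriv_eq_zero isPreconnected_Ioo
    (fun s hs => (hderiv s hs).differentiableAt.differentiableWithinAt) fun s hs =>
      (hderiv s hs).deriv
  have hF : Tendsto F (𝓝[>] 0) (𝓝 ((∫ x in Ioi 0, f x) + 0)) :=
    (intervalIntegral_tendsto_integral_Ioi 0 hf.integrableOn hlim).add nhdsWithin_le_nhds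
  have hFc : Tendsto F (𝓝[>] 0) (𝓝 c) := by
    refine tendsto_const_nhds.congr' ?_
    filter_upwards [Ioo_mem_nhdsGT (hs.1.trans hs.2)] with x hx using (hc x hx).symm
  have hsplit := intervalIntegral.integral_interval_add_Ioi (a := 0) (b := y s)
    hf.integrableOn hf.integrableOn
  have hFs : F s = (∫ x in Ioi 0, f x) + 0 := (hc s hs).trans (tendsto_nhds_unique hFc hF)
  simp only [F] at hFs
  linarith

theorem one_sub_sq_mul_sin_sq_pos {k : ℝ} (hk : k ^ 2 < 1) (φ : ℝ) :
    0 < 1 - k ^ 2 * Real.sin φ ^ 2 := by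
  nlinarith [Real.sin_sq_le_one φ, sq_nonneg k]

theorem hasDerivAt_ellipticF {k : ℝ} (hk : k ^ 2 < 1) (φ : ℝ) :
    HasDerivAt (ellipticF k) (1 / √(1 - k ^ 2 * Real.sin φ ^ 2)) φ := by
  have hcont : Continuous fun φ : ℝ => 1 / √(1 - k ^ 2 * Real.sin φ ^ 2) :=
    continuous_const.div (by fun_prop) fun φ =>
      (Real.sqrt_pos.mpr (one_sub_sq_mul_sin_sq_pos hk φ)).ne'
  exact (hcont.integral_hasStrictDerivAt 0 φ).hasDerivAt

theorem strictMono_ellipticF {k : ℝ} (hk : k ^ 2 < 1) : StrictMono (ellipticF k) :=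
  strictMono_of_deriv_pos fun φ => by
    rw [(hasDerivAt_ellipticF hk φ).deriv]
    exact one_div_pos.mpr (Real.sqrt_pos.mpr (one_sub_sq_mul_sin_sq_pos hk φ))

theorem jacobiAm_ellipticF {k : ℝ} (hk : k ^ 2 < 1) (φ : ℝ) : jacobiAm (ellipticF k φ) k = φ :=
  Function.leftInverse_invFun (strictMono_ellipticF hk).injective φ

theorem hasDerivAt_ellipticF_arccot {k : ℝ} (hk : k ^ 2 < 1) (c : ℝ) :
    HasDerivAt (fun c => ellipticF k (Real.pi / 2 - Real.arctan c))
      (-ellipticWeight 1 (1 - k ^ 2) c) c := by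
  refine ((hasDerivAt_ellipticF hk _).comp c
    ((Real.hasDerivAt_arctan c).const_sub (Real.pi / 2))).congr_deriv ?_
  have hc : 0 < 1 + c ^ 2 := by positivity
  rw [Real.sin_pi_div_two_sub, Real.cos_sq_arctan, ellipticWeight,
    show (1 + c ^ 2) * (1 - k ^ 2 + c ^ 2) =
      (1 + c ^ 2) ^ 2 * (1 - k ^ 2 * (1 / (1 + c ^ 2))) by field_simp; ring,
    Real.sqrt_mul (by positivity), Real.sqrt_sq hc.le]
  field_simp

theorem integral_Ioi_ellipticWeight {k : ℝ} (hk : k ^ 2 < 1) (c : ℝ) :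
    ∫ x in Ioi c, ellipticWeight 1 (1 - k ^ 2) x =
      ellipticF k (Real.pi / 2 - Real.arctan c) := by
  have hlim : Tendsto (fun c => ellipticF k (Real.pi / 2 - Real.arctan c)) atTop (𝓝 0) := by
    have harccot : Tendsto (fun c => Real.pi / 2 - Real.arctan c) atTop (𝓝 0) := by
      simpa using (tendsto_nhds_of_tendsto_nhdsWithin Real.tendsto_arctan_atTop).const_sub
        (Real.pi / 2)
    have hzero : ellipticF k 0 = 0 := intervalIntegral.integral_same
    exact hzero ▸ (hasDerivAt_ellipticF hk 0).continuousAt.tendsto.comp harccot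
  have h := integral_Ioi_of_hasDerivAt_of_tendsto'
    (fun x _ => hasDerivAt_ellipticF_arccot hk x)
    (integrable_ellipticWeight one_pos (sub_pos.mpr hk)).integrableOn.neg (a := c) hlim
  rw [integral_neg, zero_sub] at h
  exact neg_injective h

theorem jacobiCs_integral_Ioi_ellipticWeight {k : ℝ} (hk : k ^ 2 < 1) (c : ℝ) :
    jacobiCs (∫ x in Ioi c, ellipticWeight 1 (1 - k ^ 2) x) k = c := by
  rw [integral_Ioi_ellipticWeight hk, jacobiCs, jacobiAm_ellipticF hk, Real.cos_pi_div_two_sub,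
    Real.sin_pi_div_two_sub, ← Real.tan_eq_sin_div_cos, Real.tan_arctan]

theorem ellipticWeight_mul {a b c : ℝ} (hc : c ≠ 0) (x : ℝ) :
    ellipticWeight a b (c * x) = (c ^ 2)⁻¹ * ellipticWeight (a / c ^ 2) (b / c ^ 2) x := by
  rw [ellipticWeight, ellipticWeight, ← mul_inv, ← Real.sqrt_sq (sq_nonneg c),
    ← Real.sqrt_mul (by positivity), Real.sqrt_sq (sq_nonneg c)]
  congr 2
  field_simp

theorem integral_Ioi_mul_ellipticWeight {a b c : ℝ} (hc : 0 < c) (t : ℝ) :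
    ∫ x in Ioi (c * t), ellipticWeight a b x =
      c⁻¹ * ∫ x in Ioi t, ellipticWeight (a / c ^ 2) (b / c ^ 2) x := by
  rw [← integral_comp_mul_left_Ioi' _ _ hc, smul_eq_mul]
  simp only [ellipticWeight_mul hc.ne', integral_const_mul]
  field_simp

variable {r : ℝ}

theorem ellipticWeight_thetaRatio (hr0 : 0 < r) (hr1 : r < 1) {s : ℝ}
    (hs : s ∈ Ioo 0 (-Real.log r)) :
    ellipticWeight (realThetaThree r 0 ^ 2 / realThetaTwo r 0 ^ 2)
        (r * realThetaTwo r 0 ^ 2 / realThetaThree r 0 ^ 2) (thetaRatio r s) =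
      realThetaTwo r 0 * realThetaThree r 0 * realThetaOne r s ^ 2 /
        (realThetaFour r 0 ^ 2 * (realThetaTwo r s * realThetaThree r s)) := by
  have hr : ‖r‖ < 1 := by rwa [Real.norm_of_nonneg hr0.le]
  have h₁ := realThetaOne_pos hr0 hr1 hs.1 hs.2
  have h₂ := realThetaTwo_pos hr0 hr1
  have h₃ := realThetaThree_pos hr0 hr1
  have h₄ := realThetaFour_zero_pos hr0 hr1
  have h₂s := h₂ s
  have h₃s := h₃ s
  have h₂0 := h₂ 0
  have h₃0 := h₃ 0
  have hA : realThetaThree r 0 ^ 2 / realThetaTwo r 0 ^ 2 + thetaRatio r s ^ 2 =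
      realThetaFour r 0 ^ 2 * realThetaTwo r s ^ 2 /
        (realThetaTwo r 0 ^ 2 * realThetaOne r s ^ 2) := by
    rw [realThetaFour_zero_sq_mul_realThetaTwo_sq hr0.ne' hr, thetaRatio]
    field_simp
    ring
  have hB : r * realThetaTwo r 0 ^ 2 / realThetaThree r 0 ^ 2 + thetaRatio r s ^ 2 =
      realThetaFour r 0 ^ 2 * realThetaThree r s ^ 2 /
        (realThetaThree r 0 ^ 2 * realThetaOne r s ^ 2) := by
    rw [realThetaFour_zero_sq_mul_realThetaThree_sq hr0.ne' hr, thetaRatio]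
    field_simp
    ring
  rw [ellipticWeight, hA, hB, inv_eq_iff_eq_inv, Real.sqrt_eq_iff_eq_sq (by positivity)
    (by positivity)]
  field_simp

theorem integral_Ioi_thetaRatio (hr0 : 0 < r) (hr1 : r < 1) {s : ℝ}
    (hs : s ∈ Ioo 0 (-Real.log r)) :
    ∫ x in Ioi (thetaRatio r s), ellipticWeight (realThetaThree r 0 ^ 2 / realThetaTwo r 0 ^ 2)
        (r * realThetaTwo r 0 ^ 2 / realThetaThree r 0 ^ 2) x =
      realThetaTwo r 0 * realThetaThree r 0 * s := by
  have h₂ := realThetaTwo_pos hr0 hr1 0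
  have h₃ := realThetaThree_pos hr0 hr1 0
  set c := realThetaTwo r 0 * realThetaThree r 0 with hc
  have hc0 : c ≠ 0 := by positivity
  set w := ellipticWeight (realThetaThree r 0 ^ 2 / realThetaTwo r 0 ^ 2)
    (r * realThetaTwo r 0 ^ 2 / realThetaThree r 0 ^ 2) with hw
  have hderiv (s) (hs : s ∈ Ioo 0 (-Real.log r)) :
      HasDerivAt (thetaRatio r) (-(c⁻¹ * w (thetaRatio r s))⁻¹) s := by
    refine (hasDerivAt_thetaRatio hr0 hr1 (realThetaOne_pos hr0 hr1 hs.1 hs.2).ne').congr_deriv ?_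
    rw [hw, ellipticWeight_thetaRatio hr0 hr1 hs, hc]
    field_simp
  have h := integral_Ioi_eq_of_hasDerivAt_neg_inv (f := fun x => c⁻¹ * w x)
    ((integrable_ellipticWeight (by positivity) (by positivity)).const_mul _)
    ((continuous_ellipticWeight (by positivity) (by positivity)).const_mul _)
    (fun x => (mul_pos (by positivity) (ellipticWeight_pos (by positivity) (by positivity) x)).ne')
    hderiv (tendsto_thetaRatio_atTop hr0 hr1) hs
  rw [integral_const_mul] at h
  exact (inv_mul_eq_iff_eq_mul₀ hc0).mp h

theorem jacobiCs_thetaRatio (hr0 : 0 < r) (hr1 : r < 1) {s : ℝ}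
    (hs : s ∈ Ioo 0 (-Real.log r)) :
    jacobiCs (s * realThetaThree r 0 ^ 2) (realThetaFour r 0 ^ 2 / realThetaThree r 0 ^ 2) =
      realThetaTwo r 0 / realThetaThree r 0 * thetaRatio r s := by
  have h₂ := realThetaTwo_pos hr0 hr1 0
  have h₃ := realThetaThree_pos hr0 hr1 0
  have hjacobi := realThetaThree_zero_pow_four hr0.ne' (by rwa [Real.norm_of_nonneg hr0.le])
  set k := realThetaFour r 0 ^ 2 / realThetaThree r 0 ^ 2
  set c := realThetaTwo r 0 / realThetaThree r 0
  have hk : 1 - k ^ 2 = r * realThetaTwo r 0 ^ 4 / realThetaThree r 0 ^ 4 := by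
    simp only [k]
    field_simp
    linear_combination hjacobi
  have hk1 : k ^ 2 < 1 := sub_pos.mp (hk ▸ by positivity)
  have hu : s * realThetaThree r 0 ^ 2 =
      ∫ x in Ioi (c * thetaRatio r s), ellipticWeight 1 (1 - k ^ 2) x := by
    have hA : 1 / c ^ 2 = realThetaThree r 0 ^ 2 / realThetaTwo r 0 ^ 2 := by
      simp only [c]
      field_simp
    have hB : (1 - k ^ 2) / c ^ 2 = r * realThetaTwo r 0 ^ 2 / realThetaThree r 0 ^ 2 := by
      rw [hk]
      simp only [c]
      field_simp
    rw [integral_Ioi_mul_ellipticWeight (div_pos h₂ h₃), hA, hB, integral_Ioi_thetaRatio hr0 hr1 hs]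
    field_simp
  rw [hu, jacobiCs_integral_Ioi_ellipticWeight hk1]

end EllipticIntegral

section ImaginaryArgument

variable {r : ℝ}

theorem qPochInf_mul_thetaQ_inv (hr0 : 0 < r) (hr1 : r < 1) {x : ℝ} (hx : x ≠ 0) :
    qPochInf ((r : ℂ) ^ 2) (r ^ 2) * thetaQ (r ^ 2) (x : ℂ)⁻¹ =
      ((thetaSeries r (-(r * x)) : ℝ) : ℂ) := by
  have hr0' : (r : ℂ) ≠ 0 := mod_cast hr0.ne'
  have hx' : (x : ℂ) ≠ 0 := mod_cast hx
  have hr : ‖(r : ℂ)‖ < 1 := by rwa [Complex.norm_real, Real.norm_of_nonneg hr0.le]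
  rw [ofReal_thetaSeries, ← thetaSeries_inv,
    thetaSeries_eq_triple_product hr0' hr (by simp [hr0', hx']), Complex.ofReal_neg,
    Complex.ofReal_mul,
    show -((r : ℂ) * (-((r : ℂ) * (x : ℂ)))⁻¹) = (x : ℂ)⁻¹ by field_simp,
    show -((r : ℂ) / (-((r : ℂ) * (x : ℂ)))⁻¹) = (r : ℂ) ^ 2 * (x : ℂ)⁻¹⁻¹ by field_simp]
  simp only [thetaQ, qPochInf, qPochhammer, Complex.ofReal_pow]

theorem exp_two_I_mul_I_mul (s : ℝ) :
    Complex.exp (2 * Complex.I * (Complex.I * s)) = ((Real.exp s ^ 2 : ℝ) : ℂ)⁻¹ := by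
  rw [show 2 * Complex.I * (Complex.I * s) = -((2 : ℕ) * (s : ℂ)) by
    push_cast; linear_combination 2 * (s : ℂ) * Complex.I_mul_I, Complex.exp_neg,
    Complex.exp_nat_mul]
  norm_cast

theorem exp_neg_I_mul_I_mul (s : ℝ) :
    Complex.exp (-Complex.I * (Complex.I * s)) = ((Real.exp s : ℝ) : ℂ) := by
  rw [← mul_assoc, neg_mul, Complex.I_mul_I, neg_neg, one_mul, Complex.ofReal_exp]

theorem thetaOne_I_mul (hr0 : 0 < r) (hr1 : r < 1) (s : ℝ) :
    thetaOne (Complex.I * s) r = Complex.I * ((r ^ (1 / 4 : ℝ) * realThetaOne r s : ℝ) : ℂ) := by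
  rw [thetaOne, exp_two_I_mul_I_mul, exp_neg_I_mul_I_mul, mul_assoc,
    qPochInf_mul_thetaQ_inv hr0 hr1 (by simp), realThetaOne]
  push_cast
  ring

theorem thetaTwo_I_mul (hr0 : 0 < r) (hr1 : r < 1) (s : ℝ) :
    thetaTwo (Complex.I * s) r = ((r ^ (1 / 4 : ℝ) * realThetaTwo r s : ℝ) : ℂ) := by
  rw [thetaTwo, exp_two_I_mul_I_mul, exp_neg_I_mul_I_mul, mul_assoc, ← inv_neg,
    ← Complex.ofReal_neg, qPochInf_mul_thetaQ_inv hr0 hr1 (by simp), realThetaTwo]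
  push_cast
  ring_nf

theorem thetaThree_I_mul (hr0 : 0 < r) (hr1 : r < 1) (s : ℝ) :
    thetaThree (Complex.I * s) r = ((realThetaThree r s : ℝ) : ℂ) := by
  rw [thetaThree, exp_two_I_mul_I_mul, show -(r : ℂ) * ((Real.exp s ^ 2 : ℝ) : ℂ)⁻¹ =
    ((-(Real.exp s ^ 2) / r : ℝ) : ℂ)⁻¹ by push_cast; rw [inv_div]; ring,
    qPochInf_mul_thetaQ_inv hr0 hr1 (by simp [hr0.ne']), mul_div_cancel₀ _ hr0.ne', neg_neg,
    realThetaThree]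

theorem thetaFour_I_mul (hr0 : 0 < r) (hr1 : r < 1) (s : ℝ) :
    thetaFour (Complex.I * s) r = ((realThetaFour r s : ℝ) : ℂ) := by
  rw [thetaFour, exp_two_I_mul_I_mul, show (r : ℂ) * ((Real.exp s ^ 2 : ℝ) : ℂ)⁻¹ =
    ((Real.exp s ^ 2 / r : ℝ) : ℂ)⁻¹ by push_cast; rw [inv_div]; ring,
    qPochInf_mul_thetaQ_inv hr0 hr1 (by simp [hr0.ne']), mul_div_cancel₀ _ hr0.ne', realThetaFour]

theorem thetaTwoConst_eq (hr0 : 0 < r) (hr1 : r < 1) :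
    thetaTwoConst r = r ^ (1 / 4 : ℝ) * realThetaTwo r 0 := by
  have h := thetaTwo_I_mul hr0 hr1 0
  rw [Complex.ofReal_zero, mul_zero] at h
  rw [thetaTwoConst, h, Complex.ofReal_re]

theorem thetaThreeConst_eq (hr0 : 0 < r) (hr1 : r < 1) :
    thetaThreeConst r = realThetaThree r 0 := by
  have h := thetaThree_I_mul hr0 hr1 0
  rw [Complex.ofReal_zero, mul_zero] at h
  rw [thetaThreeConst, h, Complex.ofReal_re]

theorem thetaFourConst_eq (hr0 : 0 < r) (hr1 : r < 1) :
    thetaFourConst r = realThetaFour r 0 := by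
  have h := thetaFour_I_mul hr0 hr1 0
  rw [Complex.ofReal_zero, mul_zero] at h
  rw [thetaFourConst, h, Complex.ofReal_re]

end ImaginaryArgument

section ExtensionParameter

variable {q : ℝ}

theorem sq_rpow_quarter (hq0 : 0 ≤ q) : (q ^ 2) ^ (1 / 4 : ℝ) = q ^ (1 / 2 : ℝ) := by
  rw [← Real.rpow_natCast, ← Real.rpow_mul hq0]
  norm_num

theorem rpow_half_sq (hq0 : 0 ≤ q) : (q ^ (1 / 2 : ℝ)) ^ 2 = q := by
  rw [← Real.sqrt_eq_rpow, Real.sq_sqrt hq0]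

theorem neg_log_sq (q : ℝ) : -Real.log (q ^ 2) = -2 * Real.log q := by
  rw [Real.log_pow, Nat.cast_ofNat, neg_mul]

theorem Phi_eq_thetaRatio (hq0 : 0 < q) (hq1 : q < 1) (s : ℝ) :
    Phi q s = ((thetaRatio (q ^ 2) s : ℝ) : ℂ) := by
  have hr0 : 0 < q ^ 2 := pow_pos hq0 2
  have hr1 : q ^ 2 < 1 := pow_lt_one₀ hq0.le hq1 two_ne_zero
  have hconst : Complex.I * ((q ^ (1 / 2 : ℝ) : ℝ) : ℂ) ≠ 0 :=
    mul_ne_zero Complex.I_ne_zero (mod_cast (Real.rpow_pos_of_pos hq0 _).ne')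
  rw [Phi, thetaFour_I_mul hr0 hr1, thetaOne_I_mul hr0 hr1, sq_rpow_quarter hq0.le,
    Complex.ofReal_mul, ← mul_assoc Complex.I, mul_div_assoc', mul_div_mul_left _ _ hconst,
    thetaRatio, Complex.ofReal_div]

theorem Phi_im (hq0 : 0 < q) (hq1 : q < 1) (s : ℝ) : (Phi q s).im = 0 := by
  rw [Phi_eq_thetaRatio hq0 hq1, Complex.ofReal_im]

theorem strictAntiOn_Phi (hq0 : 0 < q) (hq1 : q < 1) :
    StrictAntiOn (fun s : ℝ => (Phi q s).re) (Ioo 0 (-2 * Real.log q)) := by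
  have h := strictAntiOn_thetaRatio (pow_pos hq0 2) (pow_lt_one₀ hq0.le hq1 two_ne_zero)
  rw [neg_log_sq] at h
  simpa only [Phi_eq_thetaRatio hq0 hq1, Complex.ofReal_re] using h

theorem Phi_re_eq_jacobiCs (hq0 : 0 < q) (hq1 : q < 1) {s : ℝ}
    (hs : s ∈ Ioo 0 (-2 * Real.log q)) :
    (Phi q s).re = q ^ (1 / 2 : ℝ) * (thetaThreeConst (q ^ 2) / thetaTwoConst (q ^ 2)) *
      jacobiCs (s * thetaThreeConst (q ^ 2) ^ 2)
        (thetaFourConst (q ^ 2) ^ 2 / thetaThreeConst (q ^ 2) ^ 2) := by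
  have hr0 : 0 < q ^ 2 := pow_pos hq0 2
  have hr1 : q ^ 2 < 1 := pow_lt_one₀ hq0.le hq1 two_ne_zero
  have h₂ := realThetaTwo_pos hr0 hr1 0
  have h₃ := realThetaThree_pos hr0 hr1 0
  have hqhalf : 0 < q ^ (1 / 2 : ℝ) := Real.rpow_pos_of_pos hq0 _
  rw [← neg_log_sq] at hs
  rw [Phi_eq_thetaRatio hq0 hq1, Complex.ofReal_re, thetaThreeConst_eq hr0 hr1,
    thetaTwoConst_eq hr0 hr1, thetaFourConst_eq hr0 hr1, jacobiCs_thetaRatio hr0 hr1 hs,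
    sq_rpow_quarter hq0.le]
  field_simp

theorem ellipticIntegrand_eq_ellipticWeight (hq0 : 0 < q) (hq1 : q < 1) :
    ellipticIntegrand q =
      ellipticWeight (realThetaThree (q ^ 2) 0 ^ 2 / realThetaTwo (q ^ 2) 0 ^ 2)
        (q ^ 2 * realThetaTwo (q ^ 2) 0 ^ 2 / realThetaThree (q ^ 2) 0 ^ 2) := by
  have hr0 : 0 < q ^ 2 := pow_pos hq0 2
  have hr1 : q ^ 2 < 1 := pow_lt_one₀ hq0.le hq1 two_ne_zero
  have h₂ := realThetaTwo_pos hr0 hr1 0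
  funext x
  rw [ellipticIntegrand, thetaThreeConst_eq hr0 hr1, thetaTwoConst_eq hr0 hr1,
    sq_rpow_quarter hq0.le, mul_pow, rpow_half_sq hq0.le, ellipticWeight, Real.sqrt_eq_rpow,
    ← Real.rpow_neg (by positivity), neg_div]
  congr 3
  · field_simp
  · ring

theorem integrable_ellipticIntegrand (hq0 : 0 < q) (hq1 : q < 1) :
    MeasureTheory.Integrable (ellipticIntegrand q) := by
  have hr0 : 0 < q ^ 2 := pow_pos hq0 2
  have hr1 : q ^ 2 < 1 := pow_lt_one₀ hq0.le hq1 two_ne_zero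
  have h₂ := realThetaTwo_pos hr0 hr1 0
  have h₃ := realThetaThree_pos hr0 hr1 0
  rw [ellipticIntegrand_eq_ellipticWeight hq0 hq1]
  exact integrable_ellipticWeight (by positivity) (by positivity)

theorem PhiExt_zero (q : ℝ) : PhiExt q 0 = OnePoint.infty := if_pos rfl

theorem PhiExt_of_ne_zero (hq0 : 0 < q) (hq1 : q < 1) {s : ℝ} (hs : s ≠ 0) :
    PhiExt q s = OnePoint.some (thetaRatio (q ^ 2) s) := by
  rw [PhiExt, if_neg hs, Phi_eq_thetaRatio hq0 hq1, Complex.ofReal_re]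

theorem PhiInv_thetaRatio (hq0 : 0 < q) (hq1 : q < 1) {s : ℝ}
    (hs : s ∈ Ioo 0 (-Real.log (q ^ 2))) :
    PhiInv q (OnePoint.some (thetaRatio (q ^ 2) s)) = s := by
  have hr0 : 0 < q ^ 2 := pow_pos hq0 2
  have hr1 : q ^ 2 < 1 := pow_lt_one₀ hq0.le hq1 two_ne_zero
  have h₂ := realThetaTwo_pos hr0 hr1 0
  have h₃ := realThetaThree_pos hr0 hr1 0
  change q ^ (1 / 2 : ℝ) / (thetaTwoConst (q ^ 2) * thetaThreeConst (q ^ 2)) *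
    ∫ x in Ioi (thetaRatio (q ^ 2) s), ellipticIntegrand q x = s
  rw [ellipticIntegrand_eq_ellipticWeight hq0 hq1, integral_Ioi_thetaRatio hr0 hr1 hs,
    thetaThreeConst_eq hr0 hr1, thetaTwoConst_eq hr0 hr1, sq_rpow_quarter hq0.le]
  field_simp

theorem leftInvOn_PhiInv (hq0 : 0 < q) (hq1 : q < 1) :
    LeftInvOn (PhiInv q) (PhiExt q) (Ico 0 (-2 * Real.log q)) := by
  intro s hs
  rcases eq_or_lt_of_le hs.1 with rfl | hs0
  · rw [PhiExt_zero]
    rfl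
  · rw [PhiExt_of_ne_zero hq0 hq1 hs0.ne']
    exact PhiInv_thetaRatio hq0 hq1 ⟨hs0, (neg_log_sq q).symm ▸ hs.2⟩

theorem surjOn_PhiExt (hq0 : 0 < q) (hq1 : q < 1) :
    SurjOn (PhiExt q) (Ico 0 (-2 * Real.log q)) univ := by
  have hL : 0 < -2 * Real.log q := mul_pos_of_neg_of_neg (by norm_num) (Real.log_neg hq0 hq1)
  intro t _
  induction t using OnePoint.rec with
  | infty => exact ⟨0, ⟨le_rfl, hL⟩, PhiExt_zero q⟩
  | coe t =>
    obtain ⟨s, hs, rfl⟩ := surjOn_thetaRatio (pow_pos hq0 2)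
      (pow_lt_one₀ hq0.le hq1 two_ne_zero) (mem_univ t)
    exact ⟨s, ⟨hs.1.le, neg_log_sq q ▸ hs.2⟩, PhiExt_of_ne_zero hq0 hq1 hs.1.ne'⟩

theorem bijOn_PhiExt (hq0 : 0 < q) (hq1 : q < 1) :
    BijOn (PhiExt q) (Ico 0 (-2 * Real.log q)) univ :=
  ⟨mapsTo_univ _ _, (leftInvOn_PhiInv hq0 hq1).injOn, surjOn_PhiExt hq0 hq1⟩

theorem invOn_PhiInv (hq0 : 0 < q) (hq1 : q < 1) :
    InvOn (PhiInv q) (PhiExt q) (Ico 0 (-2 * Real.log q)) univ :=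
  ⟨leftInvOn_PhiInv hq0 hq1,
    (leftInvOn_PhiInv hq0 hq1).rightInvOn_image.mono (surjOn_PhiExt hq0 hq1)⟩

/-- `Φ` on the whole real line, as a map into `ℝ ∪ {∞}` with the value `∞` at the zeros of `ϑ₁`. -/
noncomputable def thetaPoint (q s : ℝ) : OnePoint ℝ :=
  open Classical in
  if realThetaOne (q ^ 2) s = 0 then OnePoint.infty else OnePoint.some (thetaRatio (q ^ 2) s)

theorem thetaPoint_periodic (hq0 : 0 < q) :
    Function.Periodic (thetaPoint q) (-2 * Real.log q) := by
  intro s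
  have hr0 : 0 < q ^ 2 := pow_pos hq0 2
  have hfactor : -(q ^ 2 * Real.exp (s + -2 * Real.log q) ^ 2)⁻¹ ≠ 0 := by simp [hq0.ne']
  have hs : s + -2 * Real.log q + Real.log (q ^ 2) = s := by rw [← neg_log_sq]; ring
  have hone := realThetaOne_add_log hr0 (s + -2 * Real.log q)
  have hratio := thetaRatio_add_log hr0 (s + -2 * Real.log q)
  rw [hs] at hone hratio
  simp only [thetaPoint, hone, hratio, mul_eq_zero, hfactor, false_or]

theorem thetaPoint_eq_PhiExt (hq0 : 0 < q) (hq1 : q < 1) {s : ℝ}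
    (hs : s ∈ Ico 0 (-2 * Real.log q)) : thetaPoint q s = PhiExt q s := by
  have hr0 : 0 < q ^ 2 := pow_pos hq0 2
  have hr1 : q ^ 2 < 1 := pow_lt_one₀ hq0.le hq1 two_ne_zero
  rcases eq_or_lt_of_le hs.1 with rfl | hs0
  · rw [PhiExt_zero, thetaPoint, if_pos (realThetaOne_zero hr0)]
  · have hone := realThetaOne_pos hr0 hr1 hs0 ((neg_log_sq q).symm ▸ hs.2)
    rw [PhiExt_of_ne_zero hq0 hq1 hs0.ne', thetaPoint, if_neg hone.ne']

theorem thetaPoint_eq_iff (hq0 : 0 < q) (hq1 : q < 1) (s : ℝ) (t : OnePoint ℝ) :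
    thetaPoint q s = t ↔ ∃ m : ℤ, s = PhiInv q t + m * (-2 * Real.log q) := by
  have hL : 0 < -2 * Real.log q := mul_pos_of_neg_of_neg (by norm_num) (Real.log_neg hq0 hq1)
  have hperiod := thetaPoint_periodic hq0
  constructor
  · rintro rfl
    obtain ⟨m, hm, -⟩ := existsUnique_sub_zsmul_mem_Ico hL s 0
    rw [zero_add, zsmul_eq_mul] at hm
    refine ⟨m, ?_⟩
    rw [← hperiod.sub_int_mul_eq m, thetaPoint_eq_PhiExt hq0 hq1 hm, leftInvOn_PhiInv hq0 hq1 hm,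
      sub_add_cancel]
  · rintro ⟨m, rfl⟩
    obtain ⟨σ, hσ, rfl⟩ := surjOn_PhiExt hq0 hq1 (mem_univ t)
    rw [leftInvOn_PhiInv hq0 hq1 hσ, hperiod.int_mul m, thetaPoint_eq_PhiExt hq0 hq1 hσ]

end ExtensionParameter

section IntegerSequences

variable {𝕜 : Type*} [NormedField 𝕜] {r : 𝕜}

theorem tendsto_zpow_neg_mul_atBot (hr : ‖r‖ < 1) {f : ℤ → 𝕜} {C : ℝ} (hf : ∀ n, ‖f n‖ ≤ C) :
    Tendsto (fun n => r ^ (-n) * f n) atBot (𝓝 0) := by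
  have hpow : Tendsto (fun n : ℤ => r ^ n) atTop (𝓝 0) := by
    rw [← Nat.map_cast_int_atTop, tendsto_map'_iff]
    simpa only [Function.comp_def, zpow_natCast] using
      tendsto_pow_atTop_nhds_zero_of_norm_lt_one hr
  exact (hpow.comp tendsto_neg_atBot_atTop).zero_mul_isBoundedUnder_le
    (isBoundedUnder_of ⟨C, hf⟩)

theorem eq_of_periodic_one_of_tendsto_atBot {X : Type*} [TopologicalSpace X] [T2Space X]
    {f : ℤ → X} {a : X} (hf : Function.Periodic f 1) (ha : Tendsto f atBot (𝓝 a)) (n : ℤ) :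
    f n = a := by
  have hconst : ∀ m, f m = f 0 := fun m => by
    simpa only [Int.cast_id, mul_one] using hf.int_mul_eq m
  refine tendsto_nhds_unique (tendsto_const_nhds.congr fun m => ?_) ha
  rw [hconst n, hconst m]

theorem tendsto_atTop_of_hasSum_sub {G : Type*} [AddCommGroup G] [TopologicalSpace G]
    [IsTopologicalAddGroup G] {f : ℤ → G} {s l : G} (hs : HasSum (fun n => f n - f (n - 1)) s)
    (hl : Tendsto f atBot (𝓝 l)) : Tendsto f atTop (𝓝 (s + l)) := by
  have hs' : HasSum (fun n => f n - f (n + 1)) (-s) := by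
    simpa only [Function.comp_def, Equiv.coe_addRight, add_sub_cancel_right, neg_sub] using
      ((Equiv.addRight (1 : ℤ)).hasSum_iff.2 hs).neg
  have hpartial : Tendsto (fun n : ℕ => f (-n) - f n) atTop (𝓝 (-s)) := by
    simpa only [Function.comp_def, Finset.sum_Ico_int_sub] using
      hs'.comp (Finset.tendsto_Ico_neg (R := ℤ))
  have hbot : Tendsto (fun n : ℕ => f (-n)) atTop (𝓝 l) :=
    hl.comp (tendsto_neg_atTop_atBot.comp tendsto_natCast_atTop_atTop)
  rw [← Nat.map_cast_int_atTop, tendsto_map'_iff]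
  simpa only [Function.comp_def, sub_sub_cancel, sub_neg_eq_add, add_comm] using
    hbot.sub hpartial

theorem summable_norm_zpow_mul (hr0 : r ≠ 0) (hr : ‖r‖ < 1) {f : ℤ → 𝕜} {K L : ℝ}
    (hK : ∀ n, ‖f n‖ ≤ K) (hL : ∀ n, ‖(r ^ 2) ^ n * f n‖ ≤ L) :
    Summable fun n => ‖r ^ n * f n‖ := by
  have hgeom := summable_geometric_of_lt_one (norm_nonneg r) hr
  refine .of_nat_of_neg
    (.of_nonneg_of_le (fun _ => norm_nonneg _) (fun n => ?_) (hgeom.mul_right K))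
    (.of_nonneg_of_le (fun _ => norm_nonneg _) (fun n => ?_) (hgeom.mul_right L))
  · rw [norm_mul, zpow_natCast, norm_pow]
    gcongr
    exact hK n
  · have hsplit : r ^ (-(n : ℤ)) = r ^ n * (r ^ 2) ^ (-(n : ℤ)) := by
      rw [← zpow_natCast, ← zpow_natCast r 2, ← zpow_mul, ← zpow_add₀ hr0]
      congr 1
      push_cast
      ring
    rw [hsplit, mul_assoc, norm_mul, norm_pow]
    gcongr
    exact hL _

theorem hasSum_int_even_add_odd {G : Type*} [AddCommMonoid G] [TopologicalSpace G]
    [ContinuousAdd G] {f : ℤ → G} {a b : G} (ha : HasSum (fun n => f (2 * n)) a)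
    (hb : HasSum (fun n => f (2 * n + 1)) b) : HasSum f (a + b) := by
  have heven := mul_right_injective₀ (two_ne_zero' ℤ)
  replace ha := heven.hasSum_range_iff.2 ha
  replace hb := ((add_left_injective 1).comp heven).hasSum_range_iff.2 hb
  refine ha.add_isCompl ?_ hb
  simpa [Function.comp_def] using Int.isCompl_even_odd

theorem exists_tendsto_of_norm_sub_add_one_le {E : Type*} [NormedAddCommGroup E] [CompleteSpace E]
    {f : ℤ → E} {ρ C : ℝ} (hρ : ρ < 1) (hf : ∀ n : ℕ, ‖f n - f (n + 1)‖ ≤ C * ρ ^ n) :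
    ∃ l, Tendsto f atTop (𝓝 l) := by
  rw [← Nat.map_cast_int_atTop]
  simp only [tendsto_map'_iff]
  refine cauchySeq_tendsto_of_complete (cauchySeq_of_le_geometric ρ C hρ fun n => ?_)
  simpa only [Function.comp_apply, dist_eq_norm, Nat.cast_add_one] using hf n

end IntegerSequences

/-- The coefficients `(-q)⁻ⁿ ψ₂ₙ` of a sequence at the even sites. The factor `(-q)ⁿ` is the
solution of `𝒜 ψ = 0` at these sites, so that `𝒜` acts on the coefficients as a weighted
difference operator. -/
noncomputable def evenPart (q : ℝ) (ψ : ℤ → ℂ) (n : ℤ) : ℂ := (-q : ℂ) ^ (-n) * ψ (2 * n)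

/-- The coefficients `(-q)⁻ⁿ ψ₂ₙ₊₁` of a sequence at the odd sites, see `evenPart`. -/
noncomputable def oddPart (q : ℝ) (ψ : ℤ → ℂ) (n : ℤ) : ℂ := (-q : ℂ) ^ (-n) * ψ (2 * n + 1)

/-- The sequence with even part `u` and odd part `v`. -/
noncomputable def interlace (q : ℝ) (u v : ℤ → ℂ) (n : ℤ) : ℂ :=
  (-q : ℂ) ^ (n / 2) * if Even n then u (n / 2) else v (n / 2)

section Parts

variable {q : ℝ} {ψ χ : ℤ → ℂ}

theorem evenPart_interlace (hq0 : q ≠ 0) (u v : ℤ → ℂ) : evenPart q (interlace q u v) = u := by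
  funext n
  have hq : (-q : ℂ) ^ n ≠ 0 := zpow_ne_zero n (by simpa)
  rw [evenPart, interlace, if_pos (even_two_mul n), Int.mul_ediv_cancel_left n two_ne_zero,
    zpow_neg, inv_mul_cancel_left₀ hq]

theorem oddPart_interlace (hq0 : q ≠ 0) (u v : ℤ → ℂ) : oddPart q (interlace q u v) = v := by
  funext n
  have hq : (-q : ℂ) ^ n ≠ 0 := zpow_ne_zero n (by simpa)
  rw [oddPart, interlace, if_neg (Int.not_even_two_mul_add_one n),
    show (2 * n + 1) / 2 = n by lia, zpow_neg, inv_mul_cancel_left₀ hq]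

theorem apply_two_mul_eq_evenPart (hq0 : q ≠ 0) (ψ : ℤ → ℂ) (n : ℤ) :
    ψ (2 * n) = (-q : ℂ) ^ n * evenPart q ψ n := by
  rw [evenPart, zpow_neg, mul_inv_cancel_left₀ (zpow_ne_zero n (by simpa))]

theorem apply_two_mul_add_one_eq_oddPart (hq0 : q ≠ 0) (ψ : ℤ → ℂ) (n : ℤ) :
    ψ (2 * n + 1) = (-q : ℂ) ^ n * oddPart q ψ n := by
  rw [oddPart, zpow_neg, mul_inv_cancel_left₀ (zpow_ne_zero n (by simpa))]

theorem eq_of_evenPart_eq_of_oddPart_eq (hq0 : q ≠ 0) (heven : evenPart q ψ = evenPart q χ)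
    (hodd : oddPart q ψ = oddPart q χ) : ψ = χ := by
  funext n
  obtain ⟨m, rfl | rfl⟩ := n.even_or_odd'
  · rw [apply_two_mul_eq_evenPart hq0 ψ, apply_two_mul_eq_evenPart hq0 χ, heven]
  · rw [apply_two_mul_add_one_eq_oddPart hq0 ψ, apply_two_mul_add_one_eq_oddPart hq0 χ, hodd]

theorem evenPart_jacobiExpr (hq0 : q ≠ 0) (ψ : ℤ → ℂ) (n : ℤ) :
    evenPart q (jacobiExpr q ψ) n =
      ((q : ℂ) ^ 2) ^ (-n) * (oddPart q ψ n - oddPart q ψ (n - 1)) := by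
  have hq : (q : ℂ) ≠ 0 := by exact_mod_cast hq0
  rw [evenPart, oddPart, oddPart, jacobiExpr, show 2 * (n - 1) + 1 = 2 * n - 1 by ring,
    show -(n - 1) = -n + 1 by ring, zpow_add_one₀ (neg_ne_zero.2 hq), zpow_add_one₀ hq,
    ← zpow_natCast (q : ℂ) 2, ← zpow_mul, show ((2 : ℕ) : ℤ) * -n = -(2 * n) by push_cast; ring]
  ring

theorem oddPart_jacobiExpr (hq0 : q ≠ 0) (ψ : ℤ → ℂ) (n : ℤ) :
    oddPart q (jacobiExpr q ψ) n =
      ((q : ℂ) ^ 2) ^ (-n) * (evenPart q ψ n - evenPart q ψ (n + 1)) := by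
  have hq : (q : ℂ) ≠ 0 := by exact_mod_cast hq0
  rw [oddPart, evenPart, evenPart, jacobiExpr, add_sub_cancel_right,
    show 2 * n + 1 + 1 = 2 * (n + 1) by ring, show -(2 * n + 1) + 1 = -(2 * n) by ring,
    show -(2 * n + 1) = -(2 * n) - 1 by ring, show -(n + 1) = -n - 1 by ring,
    zpow_sub_one₀ (neg_ne_zero.2 hq), zpow_sub_one₀ hq, ← zpow_natCast (q : ℂ) 2, ← zpow_mul,
    show ((2 : ℕ) : ℤ) * -n = -(2 * n) by push_cast; ring]
  ring

theorem evenPart_smul (q : ℝ) (c : ℂ) (ψ : ℤ → ℂ) : evenPart q (c • ψ) = c • evenPart q ψ :=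
  funext fun _ => mul_left_comm _ c _

theorem oddPart_smul (q : ℝ) (c : ℂ) (ψ : ℤ → ℂ) : oddPart q (c • ψ) = c • oddPart q ψ :=
  funext fun _ => mul_left_comm _ c _

theorem memℓp_interlace (hq0 : q ≠ 0) {u v : ℤ → ℂ} (hu : Summable fun n => ‖(-q : ℂ) ^ n * u n‖)
    (hv : Summable fun n => ‖(-q : ℂ) ^ n * v n‖) : Memℓp (interlace q u v) 2 := by
  refine (memℓp_gen (p := 1) ?_).of_exponent_ge one_le_two
  simp only [ENNReal.toReal_one, Real.rpow_one]
  refine (hasSum_int_even_add_odd (Summable.hasSum ?_) (Summable.hasSum ?_)).summable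
  · simpa only [apply_two_mul_eq_evenPart hq0, evenPart_interlace hq0] using hu
  · simpa only [apply_two_mul_add_one_eq_oddPart hq0, oddPart_interlace hq0] using hv

end Parts

/-- The pair of limits at `+∞` of the even and the odd part of a sequence. These boundary values
exist on the maximal domain, and self-adjoint boundary conditions are linear relations between
them. -/
def HasBoundaryValues (q : ℝ) (ψ : ℤ → ℂ) (a b : ℂ) : Prop :=
  Tendsto (evenPart q ψ) atTop (𝓝 a) ∧ Tendsto (oddPart q ψ) atTop (𝓝 b)

section BoundaryValues

variable {q : ℝ} {ψ χ : ℤ → ℂ} {a b c d : ℂ}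

theorem HasBoundaryValues.add (hψ : HasBoundaryValues q ψ a b) (hχ : HasBoundaryValues q χ c d) :
    HasBoundaryValues q (ψ + χ) (a + c) (b + d) :=
  ⟨(hψ.1.add hχ.1).congr fun _ => (mul_add _ _ _).symm,
    (hψ.2.add hχ.2).congr fun _ => (mul_add _ _ _).symm⟩

theorem HasBoundaryValues.smul (k : ℂ) (hψ : HasBoundaryValues q ψ a b) :
    HasBoundaryValues q (k • ψ) (k * a) (k * b) := by
  rw [HasBoundaryValues, evenPart_smul, oddPart_smul]
  exact ⟨hψ.1.const_mul k, hψ.2.const_mul k⟩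

theorem HasBoundaryValues.star (hψ : HasBoundaryValues q ψ a b) :
    HasBoundaryValues q (star ψ) (star a) (star b) := by
  refine ⟨hψ.1.star.congr fun n => ?_, hψ.2.star.congr fun n => ?_⟩ <;>
    simp [evenPart, oddPart]

theorem exists_hasBoundaryValues (hq0 : q ≠ 0) (hq1 : |q| < 1) {C : ℝ}
    (hC : ∀ n, ‖jacobiExpr q ψ n‖ ≤ C) : ∃ a b, HasBoundaryValues q ψ a b := by
  have hr0 : ((q : ℂ) ^ 2) ≠ 0 := pow_ne_zero 2 (by exact_mod_cast hq0)
  have hweight : ∀ (n : ℕ) (z : ℂ), ‖z‖ ≤ C →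
      ‖((q : ℂ) ^ 2) ^ (n : ℤ) * ((-q : ℂ) ^ (-(n : ℤ)) * z)‖ ≤ C * |q| ^ n := fun n z hz => by
    have hpow : |q| ^ 2 = |q| * |q| := sq _
    have hqn : |q| ^ n ≠ 0 := pow_ne_zero n (abs_ne_zero.2 hq0)
    rw [zpow_natCast, zpow_neg, zpow_natCast]
    simp only [norm_mul, norm_inv, norm_pow, norm_neg, Complex.norm_real, Real.norm_eq_abs, hpow,
      mul_pow]
    rw [mul_assoc, mul_inv_cancel_left₀ hqn, mul_comm]
    gcongr
  have heven : ∀ n, evenPart q ψ n - evenPart q ψ (n + 1) =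
      ((q : ℂ) ^ 2) ^ n * oddPart q (jacobiExpr q ψ) n := fun n => by
    rw [oddPart_jacobiExpr hq0, zpow_neg, mul_inv_cancel_left₀ (zpow_ne_zero n hr0)]
  have hodd : ∀ n, oddPart q ψ (n - 1) - oddPart q ψ n =
      -(((q : ℂ) ^ 2) ^ n * evenPart q (jacobiExpr q ψ) n) := fun n => by
    rw [evenPart_jacobiExpr hq0, zpow_neg, mul_inv_cancel_left₀ (zpow_ne_zero n hr0), neg_sub]
  obtain ⟨a, ha⟩ := exists_tendsto_of_norm_sub_add_one_le hq1 fun n => by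
    rw [heven]
    exact hweight n _ (hC _)
  obtain ⟨b, hb⟩ := exists_tendsto_of_norm_sub_add_one_le (f := fun n => oddPart q ψ (n - 1)) hq1
    fun n => by
      simp only [add_sub_cancel_right]
      rw [hodd, norm_neg]
      exact hweight n _ (hC _)
  refine ⟨a, b, ha, (hb.comp (tendsto_atTop_add_const_right atTop 1 tendsto_id)).congr fun n => ?_⟩
  simp

end BoundaryValues

/-- The Wronskian of two sequences for the Jacobi matrix `𝒜`. -/
noncomputable def jacobiWronskian (q : ℝ) (ψ χ : ℤ → ℂ) (n : ℤ) : ℂ :=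
  (q : ℂ) ^ (-n) * (ψ (n + 1) * χ n - ψ n * χ (n + 1))

section Green

variable {q : ℝ} {ψ χ : ℤ → ℂ} {a b c d : ℂ}

theorem jacobiWronskian_sub (q : ℝ) (ψ χ : ℤ → ℂ) (n : ℤ) :
    jacobiWronskian q ψ χ n - jacobiWronskian q ψ χ (n - 1) =
      jacobiExpr q ψ n * χ n - ψ n * jacobiExpr q χ n := by
  rw [jacobiWronskian, jacobiWronskian, jacobiExpr, jacobiExpr, sub_add_cancel,
    show -(n - 1) = -n + 1 by ring]
  ring

theorem tendsto_jacobiWronskian_atBot (hq1 : |q| < 1) {C D : ℝ} (hψ : ∀ n, ‖ψ n‖ ≤ C)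
    (hχ : ∀ n, ‖χ n‖ ≤ D) : Tendsto (jacobiWronskian q ψ χ) atBot (𝓝 0) := by
  have hbound : ∀ i j, ‖ψ i * χ j‖ ≤ C * D := fun i j => by
    rw [norm_mul]
    exact mul_le_mul (hψ i) (hχ j) (norm_nonneg _) ((norm_nonneg _).trans (hψ i))
  exact tendsto_zpow_neg_mul_atBot (by simpa using hq1)
    fun n => (norm_sub_le _ _).trans (add_le_add (hbound _ _) (hbound _ _))

theorem jacobiWronskian_two_mul (q : ℝ) (ψ χ : ℤ → ℂ) (n : ℤ) :
    jacobiWronskian q ψ χ (2 * n) = oddPart q ψ n * evenPart q χ n -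
      evenPart q ψ n * oddPart q χ n := by
  have hpow : (q : ℂ) ^ (-(2 * n)) = (-q : ℂ) ^ (-n) * (-q : ℂ) ^ (-n) := by
    rw [← mul_zpow, neg_mul_neg, ← sq, ← zpow_natCast, ← zpow_mul]
    congr 1
    push_cast
    ring
  simp only [jacobiWronskian, oddPart, evenPart, hpow]
  ring

theorem HasBoundaryValues.tendsto_jacobiWronskian (hψ : HasBoundaryValues q ψ a b)
    (hχ : HasBoundaryValues q χ c d) :
    Tendsto (fun n => jacobiWronskian q ψ χ (2 * n)) atTop (𝓝 (b * c - a * d)) := by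
  simp only [jacobiWronskian_two_mul]
  exact (hψ.2.mul hχ.1).sub (hψ.1.mul hχ.2)

theorem jacobiExpr_star (q : ℝ) (ψ : ℤ → ℂ) : jacobiExpr q (star ψ) = star (jacobiExpr q ψ) := by
  funext n
  simp [jacobiExpr]

theorem jacobiWronskian_star_sub (φ η : (Amax q).domain) (n : ℤ) :
    jacobiWronskian q (star ⇑(φ : EllTwo)) (η : EllTwo) n -
        jacobiWronskian q (star ⇑(φ : EllTwo)) (η : EllTwo) (n - 1) =
      inner ℂ (Amax q φ n) ((η : EllTwo) n) - inner ℂ ((φ : EllTwo) n) (Amax q η n) := by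
  rw [jacobiWronskian_sub, jacobiExpr_star, RCLike.inner_apply', RCLike.inner_apply']
  rfl

theorem hasSum_jacobiWronskian_sub (φ η : (Amax q).domain) :
    HasSum (fun n => jacobiWronskian q (star ⇑(φ : EllTwo)) (η : EllTwo) n -
        jacobiWronskian q (star ⇑(φ : EllTwo)) (η : EllTwo) (n - 1))
      (inner ℂ (Amax q φ) (η : EllTwo) - inner ℂ (φ : EllTwo) (Amax q η)) := by
  have hinner : ∀ u v : EllTwo, HasSum (fun n => inner ℂ (u n) (v n)) (inner ℂ u v) :=
    lp.hasSum_inner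
  rw [funext fun n => jacobiWronskian_star_sub φ η n]
  exact (hinner (Amax q φ) η).sub (hinner φ (Amax q η))

theorem inner_Amax_sub_inner_Amax (hq1 : |q| < 1) {φ η : (Amax q).domain}
    (hφ : HasBoundaryValues q (φ : EllTwo) a b) (hη : HasBoundaryValues q (η : EllTwo) c d) :
    inner ℂ (Amax q φ) (η : EllTwo) - inner ℂ (φ : EllTwo) (Amax q η) =
      star b * c - star a * d := by
  have hbot := tendsto_jacobiWronskian_atBot hq1
    (fun n => (norm_star _).trans_le (lp.norm_apply_le_norm two_ne_zero (φ : EllTwo) n))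
    (lp.norm_apply_le_norm two_ne_zero (η : EllTwo))
  have htop := (tendsto_atTop_of_hasSum_sub (hasSum_jacobiWronskian_sub φ η) hbot).comp
    (tendsto_id.const_mul_atTop' (zero_lt_two' ℤ))
  rw [add_zero] at htop
  exact tendsto_nhds_unique htop (hφ.star.tendsto_jacobiWronskian hη)

end Green

/-- The solution of `𝒜 ψ = x ψ` which is square summable for `|q| < 1` and `x ≠ 0`. -/
noncomputable def eigenSeq (q : ℝ) (x : ℂ) : ℤ → ℂ :=
  interlace q (partialTheta ((q : ℂ) ^ 2) (-(x / q) ^ 2))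
    (x • partialTheta ((q : ℂ) ^ 2) (-x ^ 2))

section EigenSeq

variable {q : ℝ} {x : ℂ}

theorem norm_ofReal_sq_lt_one (hq1 : |q| < 1) : ‖(q : ℂ) ^ 2‖ < 1 :=
  norm_sq_lt_one (by simpa using hq1)

theorem ofReal_sq_ne_zero (hq0 : q ≠ 0) : (q : ℂ) ^ 2 ≠ 0 :=
  pow_ne_zero 2 (mod_cast hq0)

theorem ofReal_sq_mul_neg_div_sq (hq0 : q ≠ 0) (x : ℂ) :
    (q : ℂ) ^ 2 * -(x / q) ^ 2 = -x ^ 2 := by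
  have hq : (q : ℂ) ≠ 0 := mod_cast hq0
  field_simp

theorem evenPart_eigenSeq (hq0 : q ≠ 0) (x : ℂ) :
    evenPart q (eigenSeq q x) = partialTheta ((q : ℂ) ^ 2) (-(x / q) ^ 2) :=
  evenPart_interlace hq0 _ _

theorem oddPart_eigenSeq (hq0 : q ≠ 0) (x : ℂ) :
    oddPart q (eigenSeq q x) = x • partialTheta ((q : ℂ) ^ 2) (-x ^ 2) :=
  oddPart_interlace hq0 _ _

theorem jacobiExpr_eigenSeq (hq0 : q ≠ 0) (hq1 : |q| < 1) (hx : x ≠ 0) :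
    jacobiExpr q (eigenSeq q x) = x • eigenSeq q x := by
  have hr0 := ofReal_sq_ne_zero hq0
  have hr := norm_ofReal_sq_lt_one hq1
  have hy := ofReal_sq_mul_neg_div_sq hq0 x
  have hy0 : -(x / q) ^ 2 ≠ 0 := by simpa using ⟨hx, hq0⟩
  refine eq_of_evenPart_eq_of_oddPart_eq hq0 (funext fun n => ?_) (funext fun n => ?_)
  · have hsub := partialTheta_sub_sub_one hr0 hr (-(x / q) ^ 2) n
    rw [hy] at hsub
    rw [evenPart_jacobiExpr hq0, evenPart_smul, oddPart_eigenSeq hq0, evenPart_eigenSeq hq0,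
      Pi.smul_apply, Pi.smul_apply, Pi.smul_apply, ← smul_sub, hsub, mul_smul_comm, zpow_neg,
      inv_mul_cancel_left₀ (zpow_ne_zero n hr0)]
  · have hsub := partialTheta_sub_add_one hr0 hr hy0 n
    rw [zpow_add_one₀ hr0, mul_left_comm, mul_comm (-(x / q) ^ 2), hy] at hsub
    rw [oddPart_jacobiExpr hq0, oddPart_smul, oddPart_eigenSeq hq0, evenPart_eigenSeq hq0, hsub,
      zpow_neg]
    simp only [Pi.smul_apply, smul_eq_mul]
    field_simp

theorem memℓp_eigenSeq (hq0 : q ≠ 0) (hq1 : |q| < 1) (x : ℂ) : Memℓp (eigenSeq q x) 2 := by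
  have hr0 := ofReal_sq_ne_zero hq0
  have hr := norm_ofReal_sq_lt_one hq1
  have hsummable : ∀ y, Summable fun n => ‖(-q : ℂ) ^ n * partialTheta ((q : ℂ) ^ 2) y n‖ := by
    intro y
    obtain ⟨K, hK⟩ := exists_norm_partialTheta_le hr y
    obtain ⟨L, hL⟩ := exists_norm_zpow_mul_partialTheta_le hr0 hr y
    exact summable_norm_zpow_mul (neg_ne_zero.2 (mod_cast hq0)) (by simpa using hq1) hK
      (by simpa only [neg_sq] using hL)
  refine memℓp_interlace hq0 (hsummable _) (((hsummable (-x ^ 2)).mul_left ‖x‖).congr fun n => ?_)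
  rw [Pi.smul_apply, mul_smul_comm, norm_smul]

theorem hasBoundaryValues_eigenSeq (hq0 : q ≠ 0) (hq1 : |q| < 1) (x : ℂ) :
    HasBoundaryValues q (eigenSeq q x)
      (thetaSeries ((q : ℂ) ^ 2) (-(x / q) ^ 2) * (qPochhammer ((q : ℂ) ^ 2) ((q : ℂ) ^ 2))⁻¹)
      (x * (thetaSeries ((q : ℂ) ^ 2) (-x ^ 2) *
        (qPochhammer ((q : ℂ) ^ 2) ((q : ℂ) ^ 2))⁻¹)) := by
  have hr := norm_ofReal_sq_lt_one hq1
  rw [HasBoundaryValues, evenPart_eigenSeq hq0, oddPart_eigenSeq hq0]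
  exact ⟨tendsto_partialTheta hr _, (tendsto_partialTheta hr _).const_mul x⟩

/-- The eigenvector `eigenSeq q x` as an element of `ℓ²(ℤ)`. -/
noncomputable def eigenVec (hq0 : q ≠ 0) (hq1 : |q| < 1) (x : ℂ) : EllTwo :=
  ⟨eigenSeq q x, memℓp_eigenSeq hq0 hq1 x⟩

theorem eigenVec_mem_maxDomain (hq0 : q ≠ 0) (hq1 : |q| < 1) (hx : x ≠ 0) :
    eigenVec hq0 hq1 x ∈ maxDomain q := by
  change Memℓp (jacobiExpr q (eigenSeq q x)) 2
  rw [jacobiExpr_eigenSeq hq0 hq1 hx]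
  exact (memℓp_eigenSeq hq0 hq1 x).const_smul x

end EigenSeq

section AttainedBoundaryValues

variable {q : ℝ}

theorem thetaSeries_ofReal_neg_sq (hq0 : q ≠ 0) :
    thetaSeries ((q : ℂ) ^ 2) (-(q : ℂ) ^ 2) = 0 := by
  have h := realThetaOne_zero (sq_pos_of_ne_zero hq0)
  simp only [realThetaOne, Real.exp_zero, one_pow, mul_one, one_mul] at h
  rw [← Complex.ofReal_pow, ← Complex.ofReal_neg, ← ofReal_thetaSeries, h, Complex.ofReal_zero]

theorem thetaSeries_ofReal_neg_one_ne_zero (hq0 : q ≠ 0) (hq1 : |q| < 1) :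
    thetaSeries ((q : ℂ) ^ 2) (-1) ≠ 0 := by
  have hsq1 := (sq_lt_one_iff_abs_lt_one q).2 hq1
  have h := (realThetaFour_zero_pos (sq_pos_of_ne_zero hq0) hsq1).ne'
  simp only [realThetaFour, Real.exp_zero, one_pow] at h
  rw [← Complex.ofReal_pow, ← Complex.ofReal_one, ← Complex.ofReal_neg, ← ofReal_thetaSeries]
  exact Complex.ofReal_ne_zero.2 h

theorem exists_mem_maxDomain_hasBoundaryValues (hq0 : q ≠ 0) (hq1 : |q| < 1) (a b : ℂ) :
    ∃ ψ ∈ maxDomain q, HasBoundaryValues q ψ a b := by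
  have hq : (q : ℂ) ≠ 0 := mod_cast hq0
  set c := thetaSeries ((q : ℂ) ^ 2) (-1) * (qPochhammer ((q : ℂ) ^ 2) ((q : ℂ) ^ 2))⁻¹
  have hc : c ≠ 0 := mul_ne_zero (thetaSeries_ofReal_neg_one_ne_zero hq0 hq1)
    (inv_ne_zero (qPochhammer_self_ne_zero (norm_ofReal_sq_lt_one hq1)))
  have hzero : thetaSeries ((q : ℂ) ^ 2) (-(1 / q) ^ 2) = 0 := by
    rw [← thetaSeries_inv, one_div, inv_pow, ← inv_neg, inv_inv, thetaSeries_ofReal_neg_sq hq0]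
  have hleft : HasBoundaryValues q (eigenSeq q q) c 0 := by
    have h := hasBoundaryValues_eigenSeq hq0 hq1 (q : ℂ)
    rwa [div_self hq, one_pow, thetaSeries_ofReal_neg_sq hq0, zero_mul, mul_zero] at h
  have hright : HasBoundaryValues q (eigenSeq q 1) 0 c := by
    have h := hasBoundaryValues_eigenSeq hq0 hq1 1
    rwa [hzero, one_pow, zero_mul, one_mul] at h
  refine ⟨(a / c) • eigenVec hq0 hq1 q + (b / c) • eigenVec hq0 hq1 1,
    add_mem (Submodule.smul_mem _ _ (eigenVec_mem_maxDomain hq0 hq1 hq))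
      (Submodule.smul_mem _ _ (eigenVec_mem_maxDomain hq0 hq1 one_ne_zero)), ?_⟩
  have h := (hleft.smul (a / c)).add (hright.smul (b / c))
  rwa [div_mul_cancel₀ a hc, div_mul_cancel₀ b hc, mul_zero, mul_zero, add_zero, zero_add] at h

end AttainedBoundaryValues

/-- The line of boundary values labelled by `t ∈ ℝ ∪ {∞}`, namely `b + t a = 0` for real `t` and
`a = 0` for `t = ∞`. These are exactly the Lagrangian lines of the boundary form
`(a, b), (c, d) ↦ b̄ c - ā d`. -/
def OnBoundaryLine (t : OnePoint ℝ) (a b : ℂ) : Prop :=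
  match t with
  | OnePoint.some t => b + t * a = 0
  | OnePoint.infty => a = 0

section BoundaryLines

variable {t : OnePoint ℝ} {a b c d : ℂ}

theorem onBoundaryLine_infty : OnBoundaryLine OnePoint.infty a b ↔ a = 0 := Iff.rfl

theorem onBoundaryLine_coe {t : ℝ} : OnBoundaryLine (t : OnePoint ℝ) a b ↔ b + t * a = 0 := Iff.rfl

theorem onBoundaryLine_zero (t : OnePoint ℝ) : OnBoundaryLine t 0 0 := by
  cases t using OnePoint.rec <;> simp [onBoundaryLine_infty, onBoundaryLine_coe]

theorem onBoundaryLine_mul_iff {k : ℂ} (hk : k ≠ 0) :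
    OnBoundaryLine t (k * a) (k * b) ↔ OnBoundaryLine t a b := by
  cases t using OnePoint.rec <;>
    simp only [onBoundaryLine_infty, onBoundaryLine_coe, mul_left_comm _ k, ← mul_add, mul_eq_zero,
      hk, false_or]

theorem onBoundaryLine_iff_forall :
    OnBoundaryLine t c d ↔ ∀ a b, OnBoundaryLine t a b → star b * c = star a * d := by
  cases t using OnePoint.rec with
  | infty =>
    refine ⟨fun hc a b ha => ?_, fun h => onBoundaryLine_infty.2 (by simpa using h 0 1 rfl)⟩
    rw [onBoundaryLine_infty.1 hc, onBoundaryLine_infty.1 ha, mul_zero, star_zero, zero_mul]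
  | coe t =>
    have hstar : star (t : ℂ) = t := Complex.conj_ofReal t
    refine ⟨fun hcd a b hab => ?_, fun h => ?_⟩
    · rw [onBoundaryLine_coe] at hcd hab
      rw [eq_neg_of_add_eq_zero_left hcd, eq_neg_of_add_eq_zero_left hab, star_neg, star_mul',
        hstar]
      ring
    · have hline := h 1 (-t) (by simp [onBoundaryLine_coe])
      rw [star_neg, hstar, star_one] at hline
      rw [onBoundaryLine_coe]
      linear_combination -hline

theorem exists_onBoundaryLine_of_isotropic {L : Set (ℂ × ℂ)}
    (hL : ∀ u ∈ L, ∀ v ∈ L, star u.2 * v.1 = star u.1 * v.2) :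
    ∃ t, ∀ u ∈ L, OnBoundaryLine t u.1 u.2 := by
  by_cases hinfty : ∀ u ∈ L, u.1 = 0
  · exact ⟨OnePoint.infty, hinfty⟩
  push Not at hinfty
  obtain ⟨⟨a, b⟩, hab, ha⟩ := hinfty
  have hsa : star a ≠ 0 := star_ne_zero.2 ha
  obtain ⟨t, ht⟩ := Complex.conj_eq_iff_real.1 <| show star (b / a) = b / a by
    rw [star_div₀, div_eq_div_iff hsa ha, hL _ hab _ hab, mul_comm]
  refine ⟨OnePoint.some (-t), fun ⟨c, d⟩ hcd => ?_⟩
  have hform : star b * c = star a * d := hL _ hab _ hcd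
  have hb : star b = t * star a := by
    rw [(div_eq_iff ha).1 ht, star_mul', Complex.star_def, Complex.conj_ofReal]
  rw [hb, mul_assoc, mul_left_comm] at hform
  rw [onBoundaryLine_coe, ← mul_left_cancel₀ hsa hform]
  push_cast
  ring

end BoundaryLines

section BoundaryConditions

variable {q : ℝ} {t : OnePoint ℝ} {a b : ℂ}

theorem tendsto_zpow_mul_zero_iff_neg {ι 𝕜 : Type*} [NormedField 𝕜] {l : Filter ι} (r : 𝕜)
    (k : ι → ℤ) (f : ι → 𝕜) :
    Tendsto (fun i => r ^ k i * f i) l (𝓝 0) ↔ Tendsto (fun i => (-r) ^ k i * f i) l (𝓝 0) := by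
  rw [tendsto_zero_iff_norm_tendsto_zero,
    tendsto_zero_iff_norm_tendsto_zero (f := fun i => (-r) ^ k i * f i)]
  simp only [norm_mul, norm_zpow, norm_neg]

theorem HasBoundaryValues.boundaryCond_iff (hq0 : q ≠ 0) {ψ : ℤ → ℂ}
    (h : HasBoundaryValues q ψ a b) : BoundaryCond q ψ t ↔ OnBoundaryLine t a b := by
  have hneg : (-q : ℂ) ≠ 0 := neg_ne_zero.2 (mod_cast hq0)
  cases t using OnePoint.rec with
  | infty =>
    refine (tendsto_zpow_mul_zero_iff_neg _ _ _).trans ?_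
    exact ⟨tendsto_nhds_unique h.1, fun ha => ha ▸ h.1⟩
  | coe t =>
    have hright : Tendsto (fun n : ℤ => (-q : ℂ) ^ (-n) * (ψ (2 * n + 1) + t * ψ (2 * n))) atTop
        (𝓝 (b + t * a)) :=
      (h.2.add (h.1.const_mul (t : ℂ))).congr fun n => by
        rw [evenPart, oddPart]
        ring
    have hleft : Tendsto (fun n : ℤ => (-q : ℂ) ^ (-n) * (q * ψ (2 * n - 1) - t * ψ (2 * n))) atTop
        (𝓝 (-(b + t * a))) := by
      have hshift := h.2.comp (tendsto_atTop_add_const_right atTop (-1 : ℤ) tendsto_id)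
      refine neg_add' b _ ▸ (hshift.neg.sub (h.1.const_mul (t : ℂ))).congr fun n => ?_
      simp only [Function.comp_apply, id_eq, evenPart, oddPart]
      rw [show 2 * (n + -1) + 1 = 2 * n - 1 by ring, show -(n + -1) = -n + 1 by ring,
        zpow_add_one₀ hneg]
      ring
    refine (and_congr (tendsto_zpow_mul_zero_iff_neg _ _ _)
      (tendsto_zpow_mul_zero_iff_neg _ _ _)).trans ⟨fun h0 => tendsto_nhds_unique hright h0.1, ?_⟩
    intro h0
    rw [onBoundaryLine_coe] at h0
    rw [h0] at hright hleft
    exact ⟨hright, neg_zero (G := ℂ) ▸ hleft⟩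

theorem exists_hasBoundaryValues_of_mem_maxDomain (hq0 : q ≠ 0) (hq1 : |q| < 1) {ψ : EllTwo}
    (hψ : ψ ∈ maxDomain q) : ∃ a b, HasBoundaryValues q ψ a b :=
  exists_hasBoundaryValues hq0 hq1
    (lp.norm_apply_le_norm two_ne_zero (⟨jacobiExpr q ψ, hψ⟩ : EllTwo))

theorem hasBoundaryValues_basisVec (q : ℝ) (k : ℤ) : HasBoundaryValues q (basisVec k) 0 0 := by
  have hfar : ∀ᶠ n : ℤ in atTop, 2 * n ≠ k ∧ 2 * n + 1 ≠ k := by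
    filter_upwards [eventually_gt_atTop |k|] with n hn
    have := le_abs_self k
    have := abs_nonneg k
    omega
  constructor <;> refine tendsto_const_nhds.congr' ?_ <;> filter_upwards [hfar] with n hn
  · simp [evenPart, basisVec, hn.1]
  · simp [oddPart, basisVec, hn.2]

end BoundaryConditions

section SelfAdjointExtensions

theorem eq_of_le_of_isSelfAdjoint {𝕜 E : Type*} [RCLike 𝕜] [NormedAddCommGroup E]
    [InnerProductSpace 𝕜 E] [CompleteSpace E] {S T : E →ₗ.[𝕜] E} (hS : IsSelfAdjoint S)
    (hT : IsSelfAdjoint T) (hST : S ≤ T) : S = T := by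
  refine le_antisymm hST ?_
  have hadj := LinearPMap.adjoint_isFormalAdjoint hT.dense_domain
  rw [LinearPMap.isSelfAdjoint_def.1 hT] at hadj
  have hle := LinearPMap.IsFormalAdjoint.le_adjoint (T := S) (S := T) hS.dense_domain fun φ η => by
    rw [hST.2 (x := φ) (y := ⟨φ, hST.1 φ.2⟩) rfl]
    exact hadj ⟨φ, hST.1 φ.2⟩ η
  rwa [LinearPMap.isSelfAdjoint_def.1 hS] at hle

variable {q : ℝ} {t : OnePoint ℝ} {S T : EllTwo →ₗ.[ℂ] EllTwo}

theorem dense_span_basisVec : Dense (Submodule.span ℂ (range basisVec) : Set EllTwo) := by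
  rw [Submodule.dense_iff_topologicalClosure_eq_top, Submodule.topologicalClosure_eq_top_iff,
    Submodule.eq_bot_iff]
  intro ψ hψ
  refine lp.ext (funext fun n => ?_)
  have h := (Submodule.mem_orthogonal _ _).1 hψ (basisVec n)
    (Submodule.subset_span (mem_range_self n))
  rw [basisVec, lp.inner_single_left] at h
  simpa using h

theorem dense_of_Amin_le (hT : Amin q ≤ T) : Dense (T.domain : Set EllTwo) :=
  dense_span_basisVec.mono ((Amin_domain q).symm.le.trans hT.1)

theorem apply_eq_jacobiExpr_of_isFormalAdjoint (hT : Amin q ≤ T) (hST : S.IsFormalAdjoint T)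
    (ψ : S.domain) : ⇑(S ψ) = jacobiExpr q (ψ : EllTwo) := by
  funext n
  have hn : basisVec n ∈ (Amin q).domain :=
    (Amin_domain q).symm.le (Submodule.subset_span (mem_range_self n))
  have hinner := hST ψ ⟨basisVec n, hT.1 hn⟩
  rw [← hT.2 (x := ⟨basisVec n, hn⟩) rfl, Amin_basisVec, inner_add_right, inner_smul_right,
    inner_smul_right] at hinner
  simp only [basisVec, lp.inner_single_right, RCLike.inner_apply, one_mul] at hinner
  have hconj := congrArg (starRingEnd ℂ) hinner
  simp only [map_add, map_mul, map_zpow₀, Complex.conj_ofReal, Complex.conj_conj] at hconj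
  exact hconj

theorem le_Amax_of_isFormalAdjoint (hT : Amin q ≤ T) (hST : S.IsFormalAdjoint T) :
    S ≤ Amax q := by
  have hS := apply_eq_jacobiExpr_of_isFormalAdjoint hT hST
  refine ⟨fun ψ hψ => ?_, fun φ ψ hφψ => lp.ext ?_⟩
  · change Memℓp (jacobiExpr q ψ) 2
    exact hS ⟨ψ, hψ⟩ ▸ lp.memℓp _
  · rw [hS φ, hφψ]
    rfl

theorem le_At (hT : T ≤ Amax q) (hbc : ∀ ψ : T.domain, BoundaryCond q (ψ : EllTwo) t) :
    T ≤ At q t :=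
  ⟨fun ψ hψ => ⟨hbc ⟨ψ, hψ⟩, hT.1 hψ⟩, fun _ ψ h => hT.2 (y := ⟨ψ, ψ.2.2⟩) h⟩

theorem At_le_Amax (q : ℝ) (t : OnePoint ℝ) : At q t ≤ Amax q := LinearPMap.domRestrict_le

theorem Amin_le_At (hq0 : q ≠ 0) (t : OnePoint ℝ) : Amin q ≤ At q t := by
  have hspan : Submodule.span ℂ (range basisVec) ≤ boundarySubmodule q t := by
    rw [Submodule.span_le]
    rintro _ ⟨k, rfl⟩
    exact ((hasBoundaryValues_basisVec q k).boundaryCond_iff hq0).2 (onBoundaryLine_zero t)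
  exact le_At LinearPMap.domRestrict_le fun ψ => hspan ψ.2.1

theorem inner_apply_sub_inner_apply (hq1 : |q| < 1) (hS : S ≤ Amax q) (hT : T ≤ Amax q)
    {φ : S.domain} {η : T.domain} {a b c d : ℂ} (hφ : HasBoundaryValues q (φ : EllTwo) a b)
    (hη : HasBoundaryValues q (η : EllTwo) c d) :
    inner ℂ (S φ) (η : EllTwo) - inner ℂ (φ : EllTwo) (T η) = star b * c - star a * d := by
  rw [hS.2 (x := φ) (y := ⟨φ, hS.1 φ.2⟩) rfl, hT.2 (x := η) (y := ⟨η, hT.1 η.2⟩) rfl]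
  exact inner_Amax_sub_inner_Amax hq1 (φ := ⟨φ, hS.1 φ.2⟩) (η := ⟨η, hT.1 η.2⟩) hφ hη

theorem boundaryForm_eq_of_isFormalAdjoint (hq1 : |q| < 1) (hS : S ≤ Amax q) (hT : T ≤ Amax q)
    (hST : S.IsFormalAdjoint T) {φ : S.domain} {η : T.domain} {a b c d : ℂ}
    (hφ : HasBoundaryValues q (φ : EllTwo) a b) (hη : HasBoundaryValues q (η : EllTwo) c d) :
    star b * c = star a * d := by
  rw [← sub_eq_zero, ← inner_apply_sub_inner_apply hq1 hS hT hφ hη, hST φ η, sub_self]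

theorem At_isFormalAdjoint (hq0 : q ≠ 0) (hq1 : |q| < 1) (t : OnePoint ℝ) :
    (At q t).IsFormalAdjoint (At q t) := by
  intro φ η
  obtain ⟨a, b, hφ⟩ := exists_hasBoundaryValues_of_mem_maxDomain hq0 hq1 φ.2.2
  obtain ⟨c, d, hη⟩ := exists_hasBoundaryValues_of_mem_maxDomain hq0 hq1 η.2.2
  have hab := (hφ.boundaryCond_iff hq0).1 φ.2.1
  have hcd := (hη.boundaryCond_iff hq0).1 η.2.1
  rw [← sub_eq_zero, inner_apply_sub_inner_apply hq1 (At_le_Amax q t) (At_le_Amax q t) hφ hη,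
    onBoundaryLine_iff_forall.1 hcd a b hab, sub_self]

theorem isSelfAdjoint_At (hq0 : q ≠ 0) (hq1 : |q| < 1) (t : OnePoint ℝ) :
    IsSelfAdjoint (At q t) := by
  have hmin := Amin_le_At hq0 t
  have hdense := dense_of_Amin_le hmin
  have hadj := LinearPMap.adjoint_isFormalAdjoint hdense
  have hmax := le_Amax_of_isFormalAdjoint hmin hadj
  rw [LinearPMap.isSelfAdjoint_def]
  refine le_antisymm (le_At hmax fun η => ?_) ((At_isFormalAdjoint hq0 hq1 t).le_adjoint hdense)
  obtain ⟨c, d, hη⟩ := exists_hasBoundaryValues_of_mem_maxDomain hq0 hq1 (hmax.1 η.2)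
  refine (hη.boundaryCond_iff hq0).2 (onBoundaryLine_iff_forall.2 fun a b hab => ?_)
  obtain ⟨φ, hφ, hφab⟩ := exists_mem_maxDomain_hasBoundaryValues hq0 hq1 a b
  exact boundaryForm_eq_of_isFormalAdjoint hq1 (At_le_Amax q t) hmax hadj.symm
    (φ := ⟨φ, (hφab.boundaryCond_iff hq0).2 hab, hφ⟩) hφab hη

theorem exists_le_At_of_isFormalAdjoint (hq0 : q ≠ 0) (hq1 : |q| < 1) (hT : T ≤ Amax q)
    (hTT : T.IsFormalAdjoint T) : ∃ t, T ≤ At q t := by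
  obtain ⟨t, ht⟩ := exists_onBoundaryLine_of_isotropic
    (L := {u | ∃ ψ : T.domain, HasBoundaryValues q (ψ : EllTwo) u.1 u.2}) <| by
      rintro u ⟨φ, hφ⟩ v ⟨η, hη⟩
      exact boundaryForm_eq_of_isFormalAdjoint hq1 hT hT hTT hφ hη
  refine ⟨t, le_At hT fun ψ => ?_⟩
  obtain ⟨a, b, hψ⟩ := exists_hasBoundaryValues_of_mem_maxDomain hq0 hq1 (hT.1 ψ.2)
  exact (hψ.boundaryCond_iff hq0).2 (ht (a, b) ⟨ψ, hψ⟩)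

theorem Amin_le_and_isSelfAdjoint_iff (hq0 : q ≠ 0) (hq1 : |q| < 1) :
    (Amin q ≤ T ∧ IsSelfAdjoint T) ↔ ∃ t, T = At q t := by
  refine ⟨fun ⟨hmin, hT⟩ => ?_, ?_⟩
  · have hadj := LinearPMap.adjoint_isFormalAdjoint (dense_of_Amin_le hmin)
    rw [LinearPMap.isSelfAdjoint_def.1 hT] at hadj
    obtain ⟨t, ht⟩ := exists_le_At_of_isFormalAdjoint hq0 hq1
      (le_Amax_of_isFormalAdjoint hmin hadj) hadj
    exact ⟨t, eq_of_le_of_isSelfAdjoint hT (isSelfAdjoint_At hq0 hq1 t) ht⟩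
  · rintro ⟨t, rfl⟩
    exact ⟨Amin_le_At hq0 t, isSelfAdjoint_At hq0 hq1 t⟩

end SelfAdjointExtensions

section PointSpectrum

variable {q : ℝ} {t : OnePoint ℝ} {ψ χ : ℤ → ℂ} {x : ℂ} {C D : ℝ}

theorem eq_zero_of_jacobiExpr_eq_smul (hq0 : q ≠ 0) (hψ : jacobiExpr q ψ = x • ψ) {k : ℤ}
    (hk : ψ k = 0) (hk' : ψ (k + 1) = 0) : ψ = 0 := by
  have hq : ∀ n : ℤ, (q : ℂ) ^ n ≠ 0 := fun n => zpow_ne_zero n (mod_cast hq0)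
  have hpair : ∀ n, ψ n = 0 ∧ ψ (n + 1) = 0 := fun n => by
    refine Int.inductionOn' n k ⟨hk, hk'⟩ ?_ ?_ <;> rintro m - ⟨hm, hm'⟩
    · have heq := congrFun hψ (m + 1)
      rw [jacobiExpr, add_sub_cancel_right, hm, mul_zero, zero_add, Pi.smul_apply, hm',
        smul_zero] at heq
      exact ⟨hm', (mul_eq_zero.1 heq).resolve_left (hq _)⟩
    · have heq := congrFun hψ m
      rw [jacobiExpr, hm', mul_zero, add_zero, Pi.smul_apply, hm, smul_zero] at heq
      exact ⟨(mul_eq_zero.1 heq).resolve_left (hq _), by rwa [sub_add_cancel]⟩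
  exact funext fun n => (hpair n).1

theorem jacobiWronskian_eq_zero (hq1 : |q| < 1) (hψ : jacobiExpr q ψ = x • ψ)
    (hχ : jacobiExpr q χ = x • χ) (hψC : ∀ n, ‖ψ n‖ ≤ C) (hχD : ∀ n, ‖χ n‖ ≤ D) (n : ℤ) :
    jacobiWronskian q ψ χ n = 0 := by
  refine eq_of_periodic_one_of_tendsto_atBot (fun m => ?_)
    (tendsto_jacobiWronskian_atBot hq1 hψC hχD) n
  have hsub := jacobiWronskian_sub q ψ χ (m + 1)
  rwa [add_sub_cancel_right, hψ, hχ, Pi.smul_apply, Pi.smul_apply, smul_mul_assoc, mul_smul_comm,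
    sub_self, sub_eq_zero] at hsub

theorem exists_eq_smul_of_jacobiExpr_eq_smul (hq0 : q ≠ 0) (hq1 : |q| < 1)
    (hψ : jacobiExpr q ψ = x • ψ) (hχ : jacobiExpr q χ = x • χ) (hψC : ∀ n, ‖ψ n‖ ≤ C)
    (hχD : ∀ n, ‖χ n‖ ≤ D) (hne : ψ ≠ 0) : ∃ c : ℂ, χ = c • ψ := by
  obtain ⟨k, hk : ψ k ≠ 0⟩ := Function.ne_iff.1 hne
  have hwronskian := (mul_eq_zero.1 (jacobiWronskian_eq_zero hq1 hψ hχ hψC hχD k)).resolve_left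
    (zpow_ne_zero _ (mod_cast hq0))
  have hdiff : χ + -(χ k / ψ k) • ψ = 0 := by
    refine eq_zero_of_jacobiExpr_eq_smul hq0 (x := x) ?_ (k := k) ?_ ?_
    · rw [jacobiExpr_add, jacobiExpr_smul, hψ, hχ, smul_add, smul_comm]
    all_goals
      simp only [Pi.add_apply, Pi.smul_apply, smul_eq_mul]
      field_simp
    · ring
    · linear_combination -hwronskian
  exact ⟨χ k / ψ k, by rwa [neg_smul, ← sub_eq_add_neg, sub_eq_zero] at hdiff⟩

theorem eq_zero_of_jacobiExpr_eq_zero (hq0 : q ≠ 0) (hq1 : |q| < 1) (hψ : jacobiExpr q ψ = 0)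
    (hψC : ∀ n, ‖ψ n‖ ≤ C) : ψ = 0 := by
  have hr0 : ∀ n : ℤ, ((q : ℂ) ^ 2) ^ n ≠ 0 := fun n => zpow_ne_zero n (ofReal_sq_ne_zero hq0)
  have hneg : ‖(-q : ℂ)‖ < 1 := by simpa using hq1
  have hpart : evenPart q 0 = 0 ∧ oddPart q 0 = 0 :=
    ⟨funext fun _ => mul_zero _, funext fun _ => mul_zero _⟩
  refine eq_of_evenPart_eq_of_oddPart_eq hq0 ?_ ?_ <;> simp only [hpart] <;> funext n
  · refine eq_of_periodic_one_of_tendsto_atBot (fun m => ?_)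
      (tendsto_zpow_neg_mul_atBot hneg fun n => hψC (2 * n)) n
    have hodd := oddPart_jacobiExpr hq0 ψ m
    rw [hψ, hpart.2, Pi.zero_apply, zero_eq_mul, or_iff_right (hr0 _), sub_eq_zero] at hodd
    exact hodd.symm
  · refine eq_of_periodic_one_of_tendsto_atBot (fun m => ?_)
      (tendsto_zpow_neg_mul_atBot hneg fun n => hψC (2 * n + 1)) n
    have heven := evenPart_jacobiExpr hq0 ψ (m + 1)
    rwa [hψ, hpart.1, Pi.zero_apply, zero_eq_mul, or_iff_right (hr0 _), sub_eq_zero,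
      add_sub_cancel_right] at heven

theorem At_apply_eq_smul_iff (ψ : (At q t).domain) :
    At q t ψ = x • (ψ : EllTwo) ↔ jacobiExpr q (ψ : EllTwo) = x • ⇑(ψ : EllTwo) :=
  ⟨fun h => congrArg (fun χ : EllTwo => ⇑χ) h, fun h => lp.ext h⟩

theorem exists_real_of_mem_pointSpectrum_At (hq0 : q ≠ 0) (hq1 : |q| < 1)
    (hx : x ∈ pointSpectrum (At q t)) : ∃ y : ℝ, y ≠ 0 ∧ x = y := by
  obtain ⟨ψ, hψ0, hψ⟩ := hx
  have hsymm := At_isFormalAdjoint hq0 hq1 t ψ ψ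
  rw [hψ, inner_smul_left, inner_smul_right] at hsymm
  obtain ⟨y, rfl⟩ := Complex.conj_eq_iff_real.1
    (mul_right_cancel₀ (inner_self_ne_zero.2 hψ0) hsymm)
  refine ⟨y, fun hy => hψ0 (lp.ext ?_), rfl⟩
  rw [At_apply_eq_smul_iff, hy, Complex.ofReal_zero, zero_smul] at hψ
  exact eq_zero_of_jacobiExpr_eq_zero hq0 hq1 hψ (lp.norm_apply_le_norm two_ne_zero _)

theorem mem_pointSpectrum_At_iff_boundaryCond (hq0 : q ≠ 0) (hq1 : |q| < 1) (hx : x ≠ 0)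
    (hne : eigenSeq q x ≠ 0) :
    x ∈ pointSpectrum (At q t) ↔ BoundaryCond q (eigenSeq q x) t := by
  have heigen := jacobiExpr_eigenSeq hq0 hq1 hx
  constructor
  · rintro ⟨χ, hχ0, hχ⟩
    obtain ⟨c, hc⟩ := exists_eq_smul_of_jacobiExpr_eq_smul hq0 hq1
      ((At_apply_eq_smul_iff χ).1 hχ) heigen (lp.norm_apply_le_norm two_ne_zero _)
      (lp.norm_apply_le_norm two_ne_zero (eigenVec hq0 hq1 x)) fun h => hχ0 (lp.ext h)
    rw [hc]
    exact BoundaryCond.smul c χ.2.1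
  · intro hbc
    exact ⟨⟨eigenVec hq0 hq1 x, hbc, eigenVec_mem_maxDomain hq0 hq1 hx⟩,
      fun h => hne (congrArg (fun χ : EllTwo => ⇑χ) h), (At_apply_eq_smul_iff _).2 heigen⟩

theorem realThetaOne_ne_zero_or_realThetaFour_ne_zero {r : ℝ} (hr0 : 0 < r) (hr1 : r < 1) (s : ℝ) :
    realThetaOne r s ≠ 0 ∨ realThetaFour r s ≠ 0 := by
  have hnorm : ‖r‖ < 1 := by rwa [Real.norm_of_nonneg hr0.le]
  have hsq := realThetaFour_zero_sq_mul_realThetaTwo_sq hr0.ne' hnorm s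
  by_contra! h
  rw [h.1, h.2] at hsq
  have hpos := mul_pos (pow_pos (realThetaFour_zero_pos hr0 hr1) 2)
    (pow_pos (realThetaTwo_pos hr0 hr1 s) 2)
  simp [hsq] at hpos

theorem onBoundaryLine_iff_thetaPoint_eq (hq0 : 0 < q) (hq1 : q < 1) (s : ℝ) :
    OnBoundaryLine t (realThetaOne (q ^ 2) s) (-realThetaFour (q ^ 2) s) ↔
      thetaPoint q s = t := by
  have hne := realThetaOne_ne_zero_or_realThetaFour_ne_zero (pow_pos hq0 2)
    (pow_lt_one₀ hq0.le hq1 two_ne_zero) s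
  by_cases hone : realThetaOne (q ^ 2) s = 0
  · cases t using OnePoint.rec with
    | infty => simp [onBoundaryLine_infty, thetaPoint, hone]
    | coe t => simp [onBoundaryLine_coe, thetaPoint, hone, hne.resolve_left (not_not.2 hone)]
  · cases t using OnePoint.rec with
    | infty => simp [onBoundaryLine_infty, thetaPoint, hone]
    | coe t =>
      rw [onBoundaryLine_coe, neg_add_eq_zero, thetaPoint, if_neg hone, OnePoint.some_eq_iff,
        thetaRatio, div_eq_iff hone]
      exact_mod_cast Iff.rfl

theorem mem_pointSpectrum_At_iff_thetaPoint_eq (hq0 : 0 < q) (hq1 : q < 1) (hx : x ≠ 0) {k : ℂ}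
    {s : ℝ} (hk : k ≠ 0) (hbv : HasBoundaryValues q (eigenSeq q x) (k * realThetaOne (q ^ 2) s)
      (k * -realThetaFour (q ^ 2) s)) :
    x ∈ pointSpectrum (At q t) ↔ thetaPoint q s = t := by
  have hq0' := hq0.ne'
  have hq1' := (abs_of_pos hq0).trans_lt hq1
  have hne : eigenSeq q x ≠ 0 := by
    intro hzero
    have hbv0 := hbv.smul 0
    rw [hzero, smul_zero, zero_mul, zero_mul] at hbv0
    rw [hzero] at hbv
    rcases realThetaOne_ne_zero_or_realThetaFour_ne_zero (pow_pos hq0 2)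
      (pow_lt_one₀ hq0.le hq1 two_ne_zero) s with h | h
    · exact mul_ne_zero hk (mod_cast h) (tendsto_nhds_unique hbv.1 hbv0.1)
    · exact mul_ne_zero hk (neg_ne_zero.2 (mod_cast h)) (tendsto_nhds_unique hbv.2 hbv0.2)
  rw [mem_pointSpectrum_At_iff_boundaryCond hq0' hq1' hx hne, hbv.boundaryCond_iff hq0',
    onBoundaryLine_mul_iff hk, onBoundaryLine_iff_thetaPoint_eq hq0 hq1]

theorem thetaSeries_neg_exp_div_sq (hq0 : q ≠ 0) (s : ℝ) :
    thetaSeries (q ^ 2) (-(Real.exp s / q) ^ 2) = -(Real.exp s * realThetaOne (q ^ 2) s) := by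
  have hw : q ^ 2 * -(Real.exp s / q) ^ 2 = -Real.exp s ^ 2 := by field_simp
  rw [← thetaSeries_sq_mul (pow_ne_zero 2 hq0) (by simp [hq0]), hw, realThetaOne, sq (q ^ 2),
    mul_assoc, hw]
  ring_nf

theorem exists_hasBoundaryValues_eigenSeq_exp (hq0 : q ≠ 0) (hq1 : |q| < 1) (s : ℝ) :
    ∃ k : ℂ, k ≠ 0 ∧ HasBoundaryValues q (eigenSeq q (Real.exp s))
      (k * realThetaOne (q ^ 2) s) (k * -realThetaFour (q ^ 2) s) := by
  have hP := qPochhammer_self_ne_zero (norm_ofReal_sq_lt_one hq1)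
  refine ⟨-(Real.exp s * (qPochhammer ((q : ℂ) ^ 2) ((q : ℂ) ^ 2))⁻¹),
    neg_ne_zero.2 (mul_ne_zero (mod_cast (Real.exp_pos s).ne') (inv_ne_zero hP)), ?_⟩
  convert hasBoundaryValues_eigenSeq hq0 hq1 (Real.exp s) using 1
  · have hone := congrArg ((↑) : ℝ → ℂ) (thetaSeries_neg_exp_div_sq hq0 s)
    rw [ofReal_thetaSeries] at hone
    push_cast at hone ⊢
    rw [hone]
    ring
  · rw [realThetaFour, ofReal_thetaSeries]
    push_cast
    ring

theorem HasBoundaryValues.eigenSeq_neg (hq0 : q ≠ 0) {a b : ℂ}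
    (h : HasBoundaryValues q (eigenSeq q x) a b) :
    HasBoundaryValues q (eigenSeq q (-x)) a (-b) := by
  rw [HasBoundaryValues, evenPart_eigenSeq hq0, oddPart_eigenSeq hq0] at h ⊢
  rw [neg_div, neg_sq, neg_sq, neg_smul]
  exact ⟨h.1, h.2.neg⟩

theorem mem_pointSpectrum_At_iff_exists (hq0 : 0 < q) (hq1 : q < 1) :
    x ∈ pointSpectrum (At q t) ↔
      ∃ s, thetaPoint q s = t ∧ (x = (-Real.exp (-s) : ℝ) ∨ x = Real.exp s) := by
  have hq0' := hq0.ne'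
  have hq1' := (abs_of_pos hq0).trans_lt hq1
  have hneg : ∀ s, ((-Real.exp (-s) : ℝ) : ℂ) ∈ pointSpectrum (At q t) ↔ thetaPoint q s = t := by
    intro s
    obtain ⟨k, hk, hbv⟩ := exists_hasBoundaryValues_eigenSeq_exp hq0' hq1' (-s)
    have hbv' := hbv.eigenSeq_neg hq0'
    rw [realThetaOne_neg (pow_pos hq0 2), realThetaFour_neg, Complex.ofReal_neg, mul_neg,
      ← neg_mul, ← neg_mul, ← Complex.ofReal_neg] at hbv'
    exact mem_pointSpectrum_At_iff_thetaPoint_eq hq0 hq1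
      (mod_cast neg_ne_zero.2 (Real.exp_ne_zero _)) (neg_ne_zero.2 hk) hbv'
  have hpos : ∀ s, (Real.exp s : ℂ) ∈ pointSpectrum (At q t) ↔ thetaPoint q s = t := by
    intro s
    obtain ⟨k, hk, hbv⟩ := exists_hasBoundaryValues_eigenSeq_exp hq0' hq1' s
    exact mem_pointSpectrum_At_iff_thetaPoint_eq hq0 hq1 (mod_cast Real.exp_ne_zero s) hk hbv
  constructor
  · intro hx
    obtain ⟨y, hy, rfl⟩ := exists_real_of_mem_pointSpectrum_At hq0' hq1' hx
    rcases hy.lt_or_gt with hy | hy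
    · have hexp : -Real.exp (- -Real.log (-y)) = y := by
        rw [neg_neg, Real.exp_log (neg_pos.2 hy), neg_neg]
      exact ⟨-Real.log (-y), (hneg _).1 (hexp.symm ▸ hx), Or.inl (by rw [hexp])⟩
    · have hexp := Real.exp_log hy
      exact ⟨Real.log y, (hpos _).1 (hexp.symm ▸ hx), Or.inr (by rw [hexp])⟩
  · rintro ⟨s, hs, rfl | rfl⟩
    · exact (hneg s).2 hs
    · exact (hpos s).2 hs

theorem exp_mul_zpow_two_mul (hq0 : 0 < q) (p : ℝ) (m : ℤ) :
    Real.exp p * q ^ (2 * m) = Real.exp (p - m * (-2 * Real.log q)) := by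
  rw [show p - m * (-2 * Real.log q) = p + Real.log q * (2 * m : ℤ) by push_cast; ring,
    Real.exp_add, ← Real.rpow_def_of_pos hq0, Real.rpow_intCast]

theorem pointSpectrum_At (hq0 : 0 < q) (hq1 : q < 1) (t : OnePoint ℝ) :
    pointSpectrum (At q t) =
      {x : ℂ | ∃ m : ℤ, x = ((-(Real.exp (-PhiInv q t) * q ^ (2 * m)) : ℝ) : ℂ)} ∪
      {x : ℂ | ∃ n : ℤ, x = ((Real.exp (PhiInv q t) * q ^ (2 * n) : ℝ) : ℂ)} := by
  ext x
  simp only [mem_pointSpectrum_At_iff_exists hq0 hq1, thetaPoint_eq_iff hq0 hq1,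
    exp_mul_zpow_two_mul hq0, mem_union, mem_ofPred_eq]
  constructor
  · rintro ⟨_, ⟨m, rfl⟩, hx | hx⟩
    · exact Or.inl ⟨m, by rwa [← neg_add']⟩
    · exact Or.inr ⟨-m, by rwa [Int.cast_neg, neg_mul, sub_neg_eq_add]⟩
  · rintro (⟨m, hx⟩ | ⟨n, hx⟩)
    · exact ⟨_, ⟨m, rfl⟩, Or.inl (by rwa [neg_add'])⟩
    · exact ⟨_, ⟨-n, rfl⟩, Or.inr (by rwa [Int.cast_neg, neg_mul, ← sub_eq_add_neg])⟩

end PointSpectrum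

theorem mainTheorem1 (q : ℝ) (hq0 : 0 < q) (hq1 : q < 1) :
    -- the operators `A_t`, `t ∈ ℝ ∪ {∞}`, are precisely the self-adjoint extensions of `A`
    (∀ T : EllTwo →ₗ.[ℂ] EllTwo,
      (Amin q ≤ T ∧ IsSelfAdjoint T) ↔ ∃ t : OnePoint ℝ, T = At q t) ∧
    -- `Φ` is real-valued and strictly decreasing on `(0, -2 ln q)`,
    -- and maps `[0, -2 ln q)` bijectively onto `ℝ ∪ {∞}`
    (∀ s ∈ Set.Ioo 0 (-2 * Real.log q), (Phi q s).im = 0) ∧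
    StrictAntiOn (fun s : ℝ => (Phi q s).re) (Set.Ioo 0 (-2 * Real.log q)) ∧
    Set.BijOn (PhiExt q) (Set.Ico 0 (-2 * Real.log q)) Set.univ ∧
    -- `Φ` is a scaled Jacobian elliptic function `cs`
    (∀ s ∈ Set.Ioo 0 (-2 * Real.log q),
      (Phi q s).re =
        q ^ (1 / 2 : ℝ) * (thetaThreeConst (q ^ 2) / thetaTwoConst (q ^ 2)) *
          jacobiCs (s * thetaThreeConst (q ^ 2) ^ 2)
            (thetaFourConst (q ^ 2) ^ 2 / thetaThreeConst (q ^ 2) ^ 2)) ∧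
    -- the inverse of `Φ` is given by the (convergent) elliptic integral
    MeasureTheory.Integrable (ellipticIntegrand q) ∧
    Set.InvOn (PhiInv q) (PhiExt q) (Set.Ico 0 (-2 * Real.log q)) Set.univ ∧
    -- the point spectrum of `A_t`
    (∀ t : OnePoint ℝ,
      pointSpectrum (At q t) =
        {x : ℂ | ∃ m : ℤ, x = ((-(Real.exp (-PhiInv q t) * q ^ (2 * m)) : ℝ) : ℂ)} ∪
        {x : ℂ | ∃ n : ℤ, x = ((Real.exp (PhiInv q t) * q ^ (2 * n) : ℝ) : ℂ)}) := by
  have hq_abs : |q| < 1 := (abs_of_pos hq0).trans_lt hq1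
  exact ⟨fun _ => Amin_le_and_isSelfAdjoint_iff hq0.ne' hq_abs,
    fun s _ => Phi_im hq0 hq1 s, strictAntiOn_Phi hq0 hq1, bijOn_PhiExt hq0 hq1,
    fun _ hs => Phi_re_eq_jacobiCs hq0 hq1 hs, integrable_ellipticIntegrand hq0 hq1,
    invOn_PhiInv hq0 hq1, pointSpectrum_At hq0 hq1⟩
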